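/- Let $G_1=(V,E_1)$ and $G_2=(V,E_2)$ be simple graphs on a common vertex set $V$ with $|V|=n$, each of maximum degree at most $\Delta$, and let $m=|E_1\cup E_2|\ge 1$. A simultaneous $k$-edge-coloring is a map $\sigma\colon E_1\cup E_2\to\{1,\dots,k\}$ such that, for each $i\in\{1,2\}$, any two distinct edges of $E_i$ sharing an endpoint receive different colors; let $\Omega$ be the set of these colorings. Equivalently, $\Omega$ is the set of proper vertex $k$-colorings of the graph $\widehat G$ on the vertex set $E_1\cup E_2$ that is the union of the line graphs of $G_1$ and $G_2$. For a Markov chain on $\Omega$ with transition matrix $P$ and stationary distribution $\pi$, the mixing time is $\max_{X_0\in\Omega}\min\{t : d_{\mathrm{TV}}(P^t(X_0,\cdot),\pi)\le 1/4\}$. The Glauber dynamics moves from $\sigma\in\Omega$ as follows: choose $e\in E_1\cup E_2$ and a color $c\in\{1,\dots,k\}$ uniformly at random; if no neighbor of $e$ in $\widehat G$ has color $c$, recolor $e$ with $c$, and otherwise do nothing. The flip dynamics with flip probabilities $(P_i)_{i\ge 1}$ moves as follows: choose $(e,c)$ uniformly at random, and let $S$ be the set of vertices of $\widehat G$ reachable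 from $e$ by paths whose vertices are alternately colored $\sigma(e)$ and $c$ (with $S=\{e\}$ if $c=\sigma(e)$); with probability $P_{|S|}/|S|$ interchange the colors $\sigma(e)$ and $c$ on $S$, and otherwise do nothing. (i) For every $\delta>0$ there is a constant $C=C(\delta)$ such that for all such $n,\Delta,G_1,G_2$ and all integers $k>(6+\delta)\Delta$, the uniform distribution on $\Omega$ is stationary for the Glauber dynamics on $\Omega$, and its mixing time is at most $C\,m\log n$. (ii) There is an absolute constant $C$ such that for all such $n,\Delta,G_1,G_2$ and all integers $k\ge 5.948\,\Delta$, the uniform distribution on $\Omega$ is stationary for the flip dynamics on $\Omega$ with $P_1=1$, $P_2=\tfrac{137}{650}$, $P_3=\tfrac{77}{650}$, $P_4=\tfrac{47}{650}$, $P_5=\tfrac{27}{650}$, $P_6=\tfrac{12}{650}$ and $P_i=0$ for $i\ge 7$, and its mixing time is at most $C\,m\log n$. -/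

import Mathlib

/-! ### Finite Markov chains -/

/-- Total variation distance between two functions (distributions) on a finite set. -/
noncomputable def tvDist {S : Type*} [Fintype S] (μ ν : S → ℝ) : ℝ :=
  (1 / 2) * ∑ x, |μ x - ν x|

/-- `P` is a stochastic matrix and `π` is a probability distribution with `π P = π`. -/
structure IsStationaryFor {S : Type*} [Fintype S] (P : Matrix S S ℝ) (π : S → ℝ) : Prop where
  transition_nonneg : ∀ x y, 0 ≤ P x y
  transition_sum : ∀ x, ∑ y, P x y = 1
  nonneg : ∀ x, 0 ≤ π x
  sum_eq_one : ∑ x, π x = 1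
  invariant : ∀ y, ∑ x, π x * P x y = π y

/-- The mixing time `max_x min {t : d_TV(P^t(x, ·), π) ≤ ε}`; it is `⊤` if from some initial state
the distance `ε` is never reached. -/
noncomputable def mixingTime {S : Type*} [Fintype S] [DecidableEq S]
    (P : Matrix S S ℝ) (π : S → ℝ) (ε : ℝ) : ℕ∞ :=
  ⨆ x : S, ⨅ (t : ℕ) (_ : tvDist ((P ^ t) x) π ≤ ε), (t : ℕ∞)

/-- The uniform distribution on a finite set. -/
noncomputable def uniformDist (S : Type*) [Fintype S] : S → ℝ :=
  fun _ => 1 / (Fintype.card S : ℝ)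

/-! ### Glauber and flip dynamics for (not necessarily proper) vertex colorings of a graph -/

open Classical in
/-- One attempted Glauber update: recolor `v` with `c` if no neighbor of `v` has color `c`. -/
noncomputable def glauberUpdate {W : Type*} {k : ℕ} (H : SimpleGraph W)
    (σ : W → Fin k) (v : W) (c : Fin k) : W → Fin k :=
  if ∃ w, H.Adj v w ∧ σ w = c then σ else Function.update σ v c

open Classical in
/-- Transition probabilities of the Glauber dynamics: a uniformly random pair `(v, c)` is chosen
and the corresponding update is attempted. -/
noncomputable def glauberMatrix {W : Type*} [Fintype W] (H : SimpleGraph W) (k : ℕ) :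
    Matrix (W → Fin k) (W → Fin k) ℝ :=
  fun σ τ => (1 / ((Fintype.card W : ℝ) * (k : ℝ))) *
    ∑ v : W, ∑ c : Fin k, if glauberUpdate H σ v c = τ then 1 else 0

/-- The subgraph of `H` of those edges whose endpoints have the colors `a` and `b`, in some order;
its walks are the `(a, b)`-alternating walks. -/
def alternatingGraph {W : Type*} {k : ℕ} (H : SimpleGraph W) (σ : W → Fin k) (a b : Fin k) :
    SimpleGraph W where
  Adj u w := H.Adj u w ∧ ((σ u = a ∧ σ w = b) ∨ (σ u = b ∧ σ w = a))
  symm := ⟨fun _ _ h => ⟨h.1.symm, h.2.elim (fun x => .inr ⟨x.2, x.1⟩) (fun x => .inl ⟨x.2, x.1⟩)⟩⟩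
  loopless := ⟨fun _ h => h.1.ne rfl⟩

/-- The cluster `S_σ(v, c)`: the vertices reachable from `v` by a `(σ v, c)`-alternating path, with
the convention `S_σ(v, σ v) = {v}`. -/
def cluster {W : Type*} {k : ℕ} (H : SimpleGraph W) (σ : W → Fin k) (v : W) (c : Fin k) : Set W :=
  {w | if c = σ v then w = v else (alternatingGraph H σ (σ v) c).Reachable v w}

open Classical in
/-- The coloring obtained by interchanging the colors `σ v` and `c` on the cluster `S_σ(v, c)`. -/
noncomputable def flipCluster {W : Type*} {k : ℕ} (H : SimpleGraph W)
    (σ : W → Fin k) (v : W) (c : Fin k) : W → Fin k :=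
  fun w => if w ∈ cluster H σ v c then Equiv.swap (σ v) c (σ w) else σ w

open Classical in
/-- Transition probabilities of the flip dynamics with flip probabilities `p`: a uniformly random
pair `(v, c)` is chosen; with `s = |S_σ(v, c)|`, the cluster is flipped with probability `p s / s`,
and otherwise the coloring does not change. -/
noncomputable def flipMatrix {W : Type*} [Fintype W] (H : SimpleGraph W) (p : ℕ → ℝ) (k : ℕ) :
    Matrix (W → Fin k) (W → Fin k) ℝ :=
  fun σ τ => (1 / ((Fintype.card W : ℝ) * (k : ℝ))) *
    ∑ v : W, ∑ c : Fin k,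
      (p (cluster H σ v c).ncard / ((cluster H σ v c).ncard : ℝ) *
          (if flipCluster H σ v c = τ then 1 else 0) +
        (1 - p (cluster H σ v c).ncard / ((cluster H σ v c).ncard : ℝ)) *
          (if σ = τ then 1 else 0))

/-- The flip probabilities `P_1, P_2, …`; they vanish from `7` on (the dynamics is `6`-local). -/
noncomputable def flipProb : ℕ → ℝ
  | 1 => 1
  | 2 => 137 / 650
  | 3 => 77 / 650
  | 4 => 47 / 650
  | 5 => 27 / 650
  | 6 => 12 / 650
  | _ => 0

/-! ### Simultaneous edge colorings -/

/-- The set of edges `E₁ ∪ E₂`, as a type. -/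
def UnionEdge {V : Type*} (G₁ G₂ : SimpleGraph V) : Type _ :=
  {e : Sym2 V // e ∈ G₁.edgeSet ∪ G₂.edgeSet}

noncomputable instance {V : Type*} [Finite V] (G₁ G₂ : SimpleGraph V) :
    Fintype (UnionEdge G₁ G₂) :=
  @Fintype.ofFinite _ (inferInstanceAs (Finite {e : Sym2 V // e ∈ G₁.edgeSet ∪ G₂.edgeSet}))

/-- The union of the line graphs of `G₁` and `G₂`: two distinct edges are adjacent if they share an
endpoint and both belong to `E₁` or both belong to `E₂`. -/
def unionLineGraph {V : Type*} (G₁ G₂ : SimpleGraph V) : SimpleGraph (UnionEdge G₁ G₂) where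
  Adj e f := e ≠ f ∧ (∃ v, v ∈ e.1 ∧ v ∈ f.1) ∧
    ((e.1 ∈ G₁.edgeSet ∧ f.1 ∈ G₁.edgeSet) ∨ (e.1 ∈ G₂.edgeSet ∧ f.1 ∈ G₂.edgeSet))
  symm := ⟨fun _ _ h => ⟨h.1.symm, h.2.1.imp fun _ x => ⟨x.2, x.1⟩,
    h.2.2.imp (fun x => ⟨x.2, x.1⟩) (fun x => ⟨x.2, x.1⟩)⟩⟩
  loopless := ⟨fun _ h => h.1 rfl⟩

/-- Simultaneous `k`-edge-colorings: distinct edges of the same graph that share an endpoint get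
different colors. -/
def SimColoring {V : Type*} (G₁ G₂ : SimpleGraph V) (k : ℕ) : Type _ :=
  {σ : UnionEdge G₁ G₂ → Fin k //
    (∀ e f : UnionEdge G₁ G₂, e.1 ∈ G₁.edgeSet → f.1 ∈ G₁.edgeSet → e ≠ f →
      (∃ v, v ∈ e.1 ∧ v ∈ f.1) → σ e ≠ σ f) ∧
    (∀ e f : UnionEdge G₁ G₂, e.1 ∈ G₂.edgeSet → f.1 ∈ G₂.edgeSet → e ≠ f →
      (∃ v, v ∈ e.1 ∧ v ∈ f.1) → σ e ≠ σ f)}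

noncomputable instance {V : Type*} [Finite V] (G₁ G₂ : SimpleGraph V) (k : ℕ) :
    Fintype (SimColoring G₁ G₂ k) :=
  @Fintype.ofFinite _ (inferInstanceAs (Finite (Subtype _)))

noncomputable instance {V : Type*} (G₁ G₂ : SimpleGraph V) (k : ℕ) :
    DecidableEq (SimColoring G₁ G₂ k) :=
  Classical.decEq _

/-- The Glauber dynamics on simultaneous `k`-edge-colorings. -/
noncomputable def simGlauber {V : Type*} [Finite V] (G₁ G₂ : SimpleGraph V) (k : ℕ) :
    Matrix (SimColoring G₁ G₂ k) (SimColoring G₁ G₂ k) ℝ :=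
  fun σ τ => glauberMatrix (unionLineGraph G₁ G₂) k σ.1 τ.1

/-- The flip dynamics with flip probabilities `p` on simultaneous `k`-edge-colorings. -/
noncomputable def simFlip {V : Type*} [Finite V] (G₁ G₂ : SimpleGraph V) (p : ℕ → ℝ) (k : ℕ) :
    Matrix (SimColoring G₁ G₂ k) (SimColoring G₁ G₂ k) ℝ :=
  fun σ τ => flipMatrix (unionLineGraph G₁ G₂) p k σ.1 τ.1

/-!
The chains are compared on all maps from edges to colors, proper or not, with the Hamming distance
in which an edge weighs `1` if it lies in one of the two graphs and `2` if it lies in both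
(`edgeWeight`). The smaller weight of two adjacent edges is then the number of graphs that contain
both of them, so the weighted degree `∑ min (w e) (w f)` over the neighbors `f` of `e` is at most
`2 Δ * w e` (`sum_min_edgeWeight_le`), although an edge in both graphs may have about `4 Δ`
neighbors.

Path coupling is used in its dual form: no coupling is constructed, and instead the transition
operator is shown to map `1`-Lipschitz functions to `(1 - ε / m)`-Lipschitz ones. It is enough to
bound `P f X - P f Y` for colorings `X`, `Y` that differ at one site `v`, and a coupling becomes a
way of pairing the terms of the two sums. Since indicators are `1`-Lipschitz, the distance of `P ^ t`
to the stationary distribution is at most `(1 - ε / m) ^ t * 2 m` (`tvDist_pow_le`). Proper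
colorings are closed under both dynamics, and both matrices are symmetric on them, so the uniform
distribution is stationary.

For the Glauber dynamics a neighbor `u` of `v` costs at most `w v + w u ≤ 3 min (w v) (w u)`,
hence a contraction as soon as `k > 3 * 2 Δ` (`glauber_contraction`).

For the flip dynamics (`flip_contraction`) the moves are grouped by color `c`. The cluster of `v`
in one coloring is `v` together with disjoint clusters of the other coloring, each represented by
a neighbor of `v` with color `c` (`exists_isBlockDecomposition`). As in Vigoda's analysis of the
flip dynamics, the flip of this large cluster is coupled to the flip of the largest of its blocks,
and the blocks of the two colorings that have the same representative are coupled to each other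
(`sideTerm_sub_le_couplingCost`). With the given flip probabilities the cost of color `c` is at
most `-w v + (1933 / 650) ∑ min (w v) (w u)` over the neighbors `u` of color `c`
(`couplingCost_le`), and `2 * 1933 / 650 < 5.948`. Colorings that are not proper need the colors
`X v` and `Y v` to be treated separately (`sideTerm_special_le`).
-/

/-! ### Contraction of Lipschitz functions and mixing times -/

/-- `f` is `L`-Lipschitz for the `w`-weighted Hamming distance. The bound is required only for
configurations that differ at a single site; `IsHammingLip.sub_le` extends it to all pairs. -/
def IsHammingLip {W α : Type*} (w : W → ℝ) (L : ℝ) (f : (W → α) → ℝ) : Prop :=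
  ∀ v σ τ, (∀ u, u ≠ v → σ u = τ u) → f σ - f τ ≤ L * w v

theorem IsHammingLip.sub_le {W α : Type*} [DecidableEq W] {w : W → ℝ} {L : ℝ} {f : (W → α) → ℝ}
    (hf : IsHammingLip w L f) (D : Finset W) (σ τ : W → α) (h : ∀ u, u ∉ D → σ u = τ u) :
    f σ - f τ ≤ L * ∑ u ∈ D, w u := by
  induction D using Finset.induction_on generalizing σ with
  | empty =>
    have : σ = τ := funext fun u => h u (by simp)
    simp [this]
  | insert v D hv ih =>
    have h1 := hf v σ (Function.update σ v (τ v))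
      (fun u hu => by rw [Function.update_of_ne hu])
    have h2 := ih (Function.update σ v (τ v)) (fun u hu => by
      by_cases huv : u = v
      · subst huv; simp
      · rw [Function.update_of_ne huv]; exact h u (by simp [huv, hu]))
    rw [Finset.sum_insert hv]
    linarith

theorem IsHammingLip.smul {W α : Type*} {w : W → ℝ} {L : ℝ} {f : (W → α) → ℝ}
    (hf : IsHammingLip w L f) {c : ℝ} (hc : 0 ≤ c) : IsHammingLip w (c * L) (c • f) := by
  intro v σ τ h
  have := mul_le_mul_of_nonneg_left (hf v σ τ h) hc
  simp only [Pi.smul_apply, smul_eq_mul]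
  linarith

/-- A transition matrix that maps `1`-Lipschitz functions to `ρ`-Lipschitz ones contracts
geometrically under iteration. -/
theorem isHammingLip_pow_mulVec {W α : Type*} [Fintype (W → α)] [DecidableEq (W → α)]
    {w : W → ℝ} {P : Matrix (W → α) (W → α) ℝ} {ρ : ℝ} (hρ : 0 < ρ)
    (hP : ∀ f, IsHammingLip w 1 f → IsHammingLip w ρ (P.mulVec f))
    {f : (W → α) → ℝ} (hf : IsHammingLip w 1 f) (t : ℕ) :
    IsHammingLip w (ρ ^ t) ((P ^ t).mulVec f) := by
  induction t with
  | zero => simpa using hf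
  | succ t ih =>
    have h1 : IsHammingLip w 1 ((ρ ^ t)⁻¹ • (P ^ t).mulVec f) := by
      have := ih.smul (inv_nonneg.2 (pow_nonneg hρ.le t))
      rwa [inv_mul_cancel₀ (pow_pos hρ t).ne'] at this
    have h2 := (hP _ h1).smul (pow_nonneg hρ.le t)
    rw [Matrix.mulVec_smul, smul_smul, mul_inv_cancel₀ (pow_pos hρ t).ne', one_smul,
      Matrix.mulVec_mulVec, ← pow_succ', ← pow_succ] at h2
    exact h2

/-- Restricting a chain to a closed set of states, given as the range of `ι`, commutes with
iteration. -/
theorem restrict_pow_mulVec {S Ω : Type*} [Fintype S] [DecidableEq S] [Fintype Ω] [DecidableEq Ω]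
    {ι : Ω → S} (hι : Function.Injective ι) {P : Matrix S S ℝ}
    (hP : ∀ x s, s ∉ Set.range ι → P (ι x) s = 0) (f : S → ℝ) (t : ℕ) :
    ((P.submatrix ι ι) ^ t).mulVec (f ∘ ι) = (P ^ t).mulVec f ∘ ι := by
  have key : ∀ g : S → ℝ, (P.submatrix ι ι).mulVec (g ∘ ι) = P.mulVec g ∘ ι := by
    intro g
    funext x
    simp only [Matrix.mulVec, dotProduct, Matrix.submatrix_apply, Function.comp_apply]
    exact Finset.sum_of_injOn ι hι.injOn (fun _ _ => Finset.mem_coe.2 (Finset.mem_univ _))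
      (fun s _ hs => by
        rw [hP x s (by simpa using hs), zero_mul]) (fun _ _ => rfl)
  induction t generalizing f with
  | zero => simp
  | succ t ih => rw [pow_succ, ← Matrix.mulVec_mulVec, key, ih, pow_succ, ← Matrix.mulVec_mulVec]

theorem tvDist_eq_sum_pos {S : Type*} [Fintype S] {μ ν : S → ℝ}
    (h : ∑ x, μ x = ∑ x, ν x) :
    tvDist μ ν = ∑ x, (μ x - ν x) * (if ν x < μ x then 1 else 0) := by
  have h0 : ∑ x, (μ x - ν x) = 0 := by rw [Finset.sum_sub_distrib, h, sub_self]
  have h1 : ∑ x, |μ x - ν x| =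
      2 * ∑ x, (μ x - ν x) * (if ν x < μ x then 1 else 0) - ∑ x, (μ x - ν x) := by
    rw [Finset.mul_sum, ← Finset.sum_sub_distrib]
    refine Finset.sum_congr rfl fun x _ => ?_
    split_ifs with hx
    · rw [abs_of_pos (by linarith)]; ring
    · rw [abs_of_nonpos (by linarith)]; ring
  rw [tvDist, h1, h0]; ring

theorem IsStationaryFor.pow_invariant {S : Type*} [Fintype S] [DecidableEq S]
    {P : Matrix S S ℝ} {π : S → ℝ} (h : IsStationaryFor P π) (t : ℕ) :
    Matrix.vecMul π (P ^ t) = π := by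
  have h1 : Matrix.vecMul π P = π := funext fun y => h.invariant y
  induction t with
  | zero => simp
  | succ t ih => rw [pow_succ, ← Matrix.vecMul_vecMul, ih, h1]

theorem IsStationaryFor.pow_sum {S : Type*} [Fintype S] [DecidableEq S]
    {P : Matrix S S ℝ} {π : S → ℝ} (h : IsStationaryFor P π) (t : ℕ) (x : S) :
    ∑ y, (P ^ t) x y = 1 := by
  have h1 : P.mulVec 1 = 1 := funext fun y => by
    simpa [Matrix.mulVec, dotProduct] using h.transition_sum y
  have h2 : (P ^ t).mulVec 1 = 1 := by
    induction t with
    | zero => simp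
    | succ t ih => rw [pow_succ, ← Matrix.mulVec_mulVec, h1, ih]
  simpa [Matrix.mulVec, dotProduct] using congrFun h2 x

/-- Total variation bound: the indicator of a set is `1`-Lipschitz once all weights are at least
one, so a contraction of Lipschitz functions controls the distance to stationarity. -/
theorem tvDist_pow_le {W α Ω : Type*} [Fintype W] [DecidableEq W] [Fintype (W → α)]
    [DecidableEq (W → α)] [Fintype Ω] [DecidableEq Ω]
    {w : W → ℝ} (hw : ∀ v, 1 ≤ w v) {P : Matrix (W → α) (W → α) ℝ} {ρ : ℝ} (hρ : 0 < ρ)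
    (hP : ∀ f, IsHammingLip w 1 f → IsHammingLip w ρ (P.mulVec f))
    {ι : Ω → W → α} (hι : Function.Injective ι)
    (hclosed : ∀ x s, s ∉ Set.range ι → P (ι x) s = 0)
    {π : Ω → ℝ} (hπ : IsStationaryFor (P.submatrix ι ι) π) (t : ℕ) (x : Ω) :
    tvDist ((P.submatrix ι ι ^ t) x) π ≤ ρ ^ t * ∑ v, w v := by
  classical
  set Q := P.submatrix ι ι with hQ
  rw [tvDist_eq_sum_pos ((hπ.pow_sum t x).trans hπ.sum_eq_one.symm)]
  set A : Set Ω := {y | π y < (Q ^ t) x y} with hA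
  set f : (W → α) → ℝ := fun s => if s ∈ ι '' A then 1 else 0 with hfdef
  have hf : IsHammingLip w 1 f := by
    intro v σ τ _
    have := hw v
    simp only [hfdef]
    split_ifs <;> linarith
  have hfι : f ∘ ι = fun y => if π y < (Q ^ t) x y then (1 : ℝ) else 0 := by
    funext y
    simp only [hfdef, Function.comp_apply, hι.mem_set_image, hA, Set.mem_ofPred_eq]
  have hval : ∀ y, ∑ z, (Q ^ t) y z * (if π z < (Q ^ t) x z then 1 else 0)
      = ((P ^ t).mulVec f) (ι y) := by
    intro y
    have := congrFun (restrict_pow_mulVec hι hclosed f t) y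
    rw [hfι] at this
    exact this
  have hinv : ∑ z, π z * (if π z < (Q ^ t) x z then 1 else 0)
      = ∑ y, π y * ((P ^ t).mulVec f) (ι y) := by
    have h1 := hπ.pow_invariant t
    calc _ = dotProduct (Matrix.vecMul π (Q ^ t)) (f ∘ ι) := by rw [h1, hfι]; rfl
      _ = dotProduct π ((Q ^ t).mulVec (f ∘ ι)) := (Matrix.dotProduct_mulVec _ _ _).symm
      _ = _ := by rw [restrict_pow_mulVec hι hclosed f t]; rfl
  simp only [sub_mul, Finset.sum_sub_distrib]
  rw [hval, hinv]
  have h1 : ((P ^ t).mulVec f) (ι x) = ∑ y, π y * ((P ^ t).mulVec f) (ι x) := by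
    rw [← Finset.sum_mul, hπ.sum_eq_one, one_mul]
  rw [h1, ← Finset.sum_sub_distrib]
  have hlip := isHammingLip_pow_mulVec hρ hP hf t
  calc _ ≤ ∑ y, π y * (ρ ^ t * ∑ v, w v) := by
        refine Finset.sum_le_sum fun y _ => ?_
        rw [← mul_sub]
        exact mul_le_mul_of_nonneg_left (hlip.sub_le Finset.univ _ _ (by simp)) (hπ.nonneg y)
    _ = _ := by rw [← Finset.sum_mul, hπ.sum_eq_one, one_mul]

theorem mixingTime_le_of_tvDist_le {S : Type*} [Fintype S] [DecidableEq S]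
    {P : Matrix S S ℝ} {π : S → ℝ} {ε : ℝ} {t : ℕ}
    (h : ∀ x, tvDist ((P ^ t) x) π ≤ ε) :
    ∃ T : ℕ, mixingTime P π ε = (T : ℕ∞) ∧ T ≤ t := by
  have h1 : mixingTime P π ε ≤ (t : ℕ∞) :=
    iSup_le fun x => iInf₂_le t (h x)
  lift mixingTime P π ε to ℕ using (ne_top_of_le_ne_top (ENat.natCast_ne_top t) h1) with T
  exact ⟨T, rfl, by exact_mod_cast h1⟩

/-- Geometric decay at rate `1 - ε / m` gives distance `1 / 4` after about `(m / ε) log (8 m)`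
steps, which is `O(m log n)` when `m ≤ n ^ 2`. -/
theorem exists_time_of_contraction {ε : ℝ} (hε : 0 < ε) (hε1 : ε < 1) {m n : ℕ} (hm : 1 ≤ m)
    (hn : 2 ≤ n) (hmn : m ≤ n ^ 2) :
    ∃ t : ℕ, (1 - ε / m) ^ t * (2 * m) ≤ 1 / 4 ∧
      (t : ℝ) ≤ (5 / ε + 2) * m * Real.log n := by
  have hm' : (1 : ℝ) ≤ m := by exact_mod_cast hm
  have hm0 : (0 : ℝ) < m := by linarith
  have hn' : (2 : ℝ) ≤ n := by exact_mod_cast hn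
  have hlog2 : Real.log 2 ≤ Real.log n := Real.log_le_log (by norm_num) hn'
  have hl2 := Real.log_two_gt_d9
  set t := ⌈(m : ℝ) / ε * Real.log (8 * m)⌉₊ with ht
  have hlog8 : Real.log (8 * m) ≤ 5 * Real.log n := by
    have h1 : (8 * m : ℝ) ≤ (n : ℝ) ^ 5 := by
      have h2 : (m : ℝ) ≤ (n : ℝ) ^ 2 := by exact_mod_cast hmn
      have h3 : (8 : ℝ) ≤ (n : ℝ) ^ 3 := by
        calc (8 : ℝ) = 2 ^ 3 := by norm_num
          _ ≤ _ := by gcongr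
      calc (8 * m : ℝ) ≤ (n : ℝ) ^ 3 * (n : ℝ) ^ 2 := by gcongr
        _ = _ := by ring
    calc _ ≤ Real.log ((n : ℝ) ^ 5) := Real.log_le_log (by positivity) h1
      _ = _ := by rw [Real.log_pow]; norm_num
  have hlog0 : 0 ≤ Real.log (8 * m) := Real.log_nonneg (by linarith)
  refine ⟨t, ?_, ?_⟩
  · have h1 : (m : ℝ) / ε * Real.log (8 * m) ≤ t := Nat.le_ceil _
    have h2 : Real.log (8 * m) ≤ ε / m * t := by
      have := mul_le_mul_of_nonneg_left h1 (by positivity : (0 : ℝ) ≤ ε / m)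
      have e : ε / m * ((m : ℝ) / ε * Real.log (8 * m)) = Real.log (8 * m) := by
        field_simp
      linarith
    have hbase : 0 ≤ 1 - ε / m := by
      rw [sub_nonneg, div_le_one hm0]; linarith
    have h3 : (1 - ε / m) ^ t ≤ (8 * m : ℝ)⁻¹ := by
      calc (1 - ε / m) ^ t ≤ (Real.exp (-(ε / m))) ^ t := by
            gcongr
            have := Real.add_one_le_exp (-(ε / m))
            linarith
        _ = Real.exp (-(ε / m * t)) := by rw [← Real.exp_nat_mul]; ring_nf
        _ ≤ Real.exp (-Real.log (8 * m)) := by gcongr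
        _ = _ := by rw [Real.exp_neg, Real.exp_log (by positivity)]
    calc _ ≤ (8 * m : ℝ)⁻¹ * (2 * m) := by gcongr
      _ = 1 / 4 := by field_simp; norm_num
  · have h1 : (t : ℝ) ≤ m / ε * Real.log (8 * m) + 1 :=
      (Nat.ceil_lt_add_one (by positivity)).le
    have h2 : (m : ℝ) / ε * Real.log (8 * m) ≤ m / ε * (5 * Real.log n) := by gcongr
    have h3 : 1 ≤ 2 * (m * Real.log n) := by nlinarith
    calc _ ≤ (m : ℝ) / ε * (5 * Real.log n) + 2 * (m * Real.log n) := by linarith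
      _ = _ := by ring

/-! ### Contraction of the Glauber dynamics -/

open Classical in
theorem glauberMatrix_mulVec {W : Type*} [Fintype W] [DecidableEq W] (H : SimpleGraph W) (k : ℕ)
    (f : (W → Fin k) → ℝ) (σ : W → Fin k) :
    (glauberMatrix H k).mulVec f σ = (1 / ((Fintype.card W : ℝ) * (k : ℝ))) *
      ∑ v : W, ∑ c : Fin k, f (glauberUpdate H σ v c) := by
  simp only [Matrix.mulVec, dotProduct, glauberMatrix, mul_assoc, ← Finset.mul_sum]
  congr 1
  simp only [Finset.sum_mul]
  rw [Finset.sum_comm]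
  refine Finset.sum_congr rfl fun v _ => ?_
  rw [Finset.sum_comm]
  refine Finset.sum_congr rfl fun c _ => ?_
  simp [Finset.sum_ite_eq]

theorem glauberUpdate_of_exists {W : Type*} {k : ℕ} {H : SimpleGraph W} {σ : W → Fin k} {v : W}
    {c : Fin k} (h : ∃ w, H.Adj v w ∧ σ w = c) : glauberUpdate H σ v c = σ :=
  if_pos h

theorem glauberUpdate_of_not_exists {W : Type*} [DecidableEq W] {k : ℕ} {H : SimpleGraph W}
    {σ : W → Fin k} {v : W} {c : Fin k} (h : ¬ ∃ w, H.Adj v w ∧ σ w = c) :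
    glauberUpdate H σ v c = Function.update σ v c := by
  unfold glauberUpdate
  rw [if_neg h]
  congr
  exact Subsingleton.elim _ _

theorem glauberUpdate_of_ne {W : Type*} {k : ℕ} (H : SimpleGraph W)
    (σ : W → Fin k) {u v : W} (c : Fin k) (h : u ≠ v) : glauberUpdate H σ v c u = σ u := by
  classical
  by_cases hb : ∃ w, H.Adj v w ∧ σ w = c
  · rw [glauberUpdate_of_exists hb]
  · rw [glauberUpdate_of_not_exists hb, Function.update_of_ne h]

section
variable {W : Type*} [Fintype W] [DecidableEq W] {k : ℕ} (H : SimpleGraph W)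
  {w : W → ℝ} {f : (W → Fin k) → ℝ} {v : W} {X Y : W → Fin k}

/-- Updates at the site of disagreement: they coalesce unless the color is blocked, and the blocked
colors number at most `deg v`. -/
theorem sum_glauberUpdate_self_le [DecidableRel H.Adj] (hw : 0 ≤ w v) (hf : IsHammingLip w 1 f)
    (hXY : ∀ u, u ≠ v → X u = Y u) :
    ∑ c, (f (glauberUpdate H X v c) - f (glauberUpdate H Y v c)) ≤
      ∑ u with H.Adj v u, w v := by
  have hiff : ∀ c, (∃ u, H.Adj v u ∧ X u = c) ↔ ∃ u, H.Adj v u ∧ Y u = c := fun c =>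
    exists_congr fun u => and_congr_right fun hu => by rw [hXY u hu.ne']
  calc _ ≤ ∑ c, if c ∈ (Finset.univ.filter (H.Adj v)).image X then w v else 0 := by
        refine Finset.sum_le_sum fun c _ => ?_
        split_ifs with hc
        · have := hf v (glauberUpdate H X v c) (glauberUpdate H Y v c) (fun u hu => by
            rw [glauberUpdate_of_ne H _ c hu, glauberUpdate_of_ne H _ c hu, hXY u hu])
          linarith
        · have hX : ¬ ∃ u, H.Adj v u ∧ X u = c := by simpa using hc
          have hY : ¬ ∃ u, H.Adj v u ∧ Y u = c := by rwa [← hiff]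
          have : glauberUpdate H X v c = glauberUpdate H Y v c := by
            rw [glauberUpdate_of_not_exists hX, glauberUpdate_of_not_exists hY]
            funext u
            by_cases hu : u = v
            · subst hu; simp
            · rw [Function.update_of_ne hu, Function.update_of_ne hu, hXY u hu]
          simp [this]
    _ = ((Finset.univ.filter (H.Adj v)).image X).card * w v := by
        rw [← Finset.sum_filter, Finset.sum_const, nsmul_eq_mul, Finset.filter_mem_eq_inter,
          Finset.univ_inter]
    _ ≤ _ := by
        rw [Finset.sum_const, nsmul_eq_mul]
        gcongr
        exact Finset.card_image_le

/-- Updates at a neighbor `u` of the disagreement `v`: the color `Y v` in `X` is paired with the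
color `X v` in `Y`, so that only one color can create a disagreement at `u`. -/
theorem sum_glauberUpdate_adj_le (hf : IsHammingLip w 1 f)
    (hXY : ∀ u, u ≠ v → X u = Y u) (hne : X v ≠ Y v) {u : W} (hu : H.Adj v u) :
    ∑ c, (f (glauberUpdate H X u c) - f (glauberUpdate H Y u c)) ≤ k * w v + w u := by
  have huv : u ≠ v := hu.ne'
  have hbase : f X - f Y ≤ w v := by simpa using hf v X Y hXY
  have hrest : ∀ c, c ≠ X v → c ≠ Y v →
      f (glauberUpdate H X u c) - f (glauberUpdate H Y u c) - w v ≤ 0 := by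
    intro c hcX hcY
    have hiff : (∃ z, H.Adj u z ∧ X z = c) ↔ ∃ z, H.Adj u z ∧ Y z = c :=
      exists_congr fun z => and_congr_right fun _ => by
        by_cases hz : z = v
        · subst hz; simp [hcX.symm, hcY.symm]
        · rw [hXY z hz]
    have := hf v (glauberUpdate H X u c) (glauberUpdate H Y u c) (fun z hz => by
      by_cases hb : ∃ z, H.Adj u z ∧ Y z = c
      · rw [glauberUpdate_of_exists (hiff.2 hb), glauberUpdate_of_exists hb, hXY z hz]
      · rw [glauberUpdate_of_not_exists (hiff.not.2 hb), glauberUpdate_of_not_exists hb]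
        by_cases hzu : z = u
        · subst hzu; simp
        · rw [Function.update_of_ne hzu, Function.update_of_ne hzu, hXY z hz])
    linarith
  have hXblock : glauberUpdate H X u (X v) = X := if_pos ⟨v, hu.symm, rfl⟩
  have hYblock : glauberUpdate H Y u (Y v) = Y := if_pos ⟨v, hu.symm, rfl⟩
  have hpair : f (glauberUpdate H X u (Y v)) - f (glauberUpdate H Y u (X v)) ≤ w v + w u := by
    have := hf.sub_le {v, u} (glauberUpdate H X u (Y v)) (glauberUpdate H Y u (X v))
      (fun z hz => by
        simp only [Finset.mem_insert, Finset.mem_singleton, not_or] at hz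
        rw [glauberUpdate_of_ne H _ _ hz.2, glauberUpdate_of_ne H _ _ hz.2, hXY z hz.1])
    rwa [Finset.sum_pair huv.symm, one_mul] at this
  have hsum : ∑ c, (f (glauberUpdate H X u c) - f (glauberUpdate H Y u c) - w v) ≤ w u := by
    rw [← Finset.sum_sdiff (Finset.subset_univ {X v, Y v}), Finset.sum_pair hne, hXblock, hYblock]
    have : ∑ c ∈ Finset.univ \ {X v, Y v},
        (f (glauberUpdate H X u c) - f (glauberUpdate H Y u c) - w v) ≤ 0 :=
      Finset.sum_nonpos fun c hc => by
        simp only [Finset.mem_sdiff, Finset.mem_univ, true_and, Finset.mem_insert,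
          Finset.mem_singleton, not_or] at hc
        exact hrest c hc.1 hc.2
    linarith
  rw [Finset.sum_sub_distrib] at hsum
  simp only [Finset.sum_const, Finset.card_univ, Fintype.card_fin, nsmul_eq_mul] at hsum
  linarith

theorem sum_glauberUpdate_far_le (hf : IsHammingLip w 1 f)
    (hXY : ∀ u, u ≠ v → X u = Y u) {u : W} (huv : u ≠ v) (hu : ¬ H.Adj v u) :
    ∑ c, (f (glauberUpdate H X u c) - f (glauberUpdate H Y u c)) ≤ k * w v := by
  calc _ ≤ ∑ _c : Fin k, w v := by
        refine Finset.sum_le_sum fun c _ => ?_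
        have hiff : (∃ z, H.Adj u z ∧ X z = c) ↔ ∃ z, H.Adj u z ∧ Y z = c :=
          exists_congr fun z => and_congr_right fun hz => by
            rw [hXY z (fun h => hu (h ▸ hz.symm))]
        have := hf v (glauberUpdate H X u c) (glauberUpdate H Y u c) (fun z hz => by
          by_cases hb : ∃ z, H.Adj u z ∧ Y z = c
          · rw [glauberUpdate_of_exists (hiff.2 hb), glauberUpdate_of_exists hb, hXY z hz]
          · rw [glauberUpdate_of_not_exists (hiff.not.2 hb), glauberUpdate_of_not_exists hb]
            by_cases hzu : z = u
            · subst hzu; simp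
            · rw [Function.update_of_ne hzu, Function.update_of_ne hzu, hXY z hz])
        linarith
    _ = _ := by simp

end

/-- The Glauber dynamics contracts the weighted Hamming distance once `k > 3 D`, where
`D` bounds the weighted degrees. With weights `1` and `2` one has
`w v + w u ≤ 3 min (w v) (w u)`, which is where the constant `3` comes from. -/
theorem glauber_contraction {W : Type*} [Fintype W] [DecidableEq W] {k : ℕ} (H : SimpleGraph W)
    [DecidableRel H.Adj] {w : W → ℝ} (hw : ∀ v, w v = 1 ∨ w v = 2) {D : ℝ} (hD : 0 ≤ D)
    (hdeg : ∀ v, ∑ u with H.Adj v u, min (w v) (w u) ≤ w v * D) (hk : 0 < k)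
    {f : (W → Fin k) → ℝ} (hf : IsHammingLip w 1 f) :
    IsHammingLip w (1 - (k - 3 * D) / (Fintype.card W * k)) ((glauberMatrix H k).mulVec f) := by
  intro v X Y hXY
  have hcard : (1 : ℝ) ≤ Fintype.card W := by
    exact_mod_cast Fintype.card_pos_iff.2 ⟨v⟩
  have hk' : (1 : ℝ) ≤ k := by exact_mod_cast hk
  have hN : (0 : ℝ) < Fintype.card W * k := by nlinarith
  have hwv : 0 < w v := by rcases hw v with h | h <;> rw [h] <;> norm_num
  by_cases hne : X v = Y v
  · have : X = Y := funext fun u => by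
      by_cases hu : u = v
      · rw [hu, hne]
      · exact hXY u hu
    rw [this, sub_self]
    refine mul_nonneg ?_ hwv.le
    rw [sub_nonneg, div_le_one hN]
    nlinarith
  rw [glauberMatrix_mulVec, glauberMatrix_mulVec, ← mul_sub, ← Finset.sum_sub_distrib]
  simp only [← Finset.sum_sub_distrib]
  have key : ∑ u, ∑ c, (f (glauberUpdate H X u c) - f (glauberUpdate H Y u c)) ≤
      (Fintype.card W * k - (k - 3 * D)) * w v := by
    calc _ ≤ ∑ u, (k * w v + (if H.Adj v u then w u else 0) +
          (if u = v then ∑ z with H.Adj v z, w v - k * w v else 0)) := by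
          refine Finset.sum_le_sum fun u _ => ?_
          by_cases huv : u = v
          · subst huv
            have := sum_glauberUpdate_self_le H hwv.le hf hXY
            simpa using this
          · by_cases hadj : H.Adj v u
            · have := sum_glauberUpdate_adj_le H hf hXY hne hadj
              simpa [huv, hadj] using this
            · have := sum_glauberUpdate_far_le H hf hXY huv hadj
              simpa [huv, hadj] using this
      _ = Fintype.card W * (k * w v) + ∑ u with H.Adj v u, (w v + w u) - k * w v := by
          rw [Finset.sum_add_distrib, Finset.sum_add_distrib, Finset.sum_ite_eq', if_pos (by simp),
            ← Finset.sum_filter, Finset.sum_add_distrib]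
          simp only [Finset.sum_const, Finset.card_univ, nsmul_eq_mul]
          ring
      _ ≤ Fintype.card W * (k * w v) + 3 * (w v * D) - k * w v := by
          have h3 : ∑ u with H.Adj v u, (w v + w u) ≤ 3 * ∑ u with H.Adj v u, min (w v) (w u) := by
            rw [Finset.mul_sum]
            refine Finset.sum_le_sum fun u _ => ?_
            rcases hw v with h | h <;> rcases hw u with h' | h' <;> rw [h, h'] <;> norm_num
          linarith [hdeg v]
      _ = _ := by ring
  calc _ ≤ 1 / (Fintype.card W * k : ℝ) * ((Fintype.card W * k - (k - 3 * D)) * w v) := by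
        gcongr
    _ = _ := by field_simp

/-! ### Clusters -/

section
variable {W : Type*} {k : ℕ} {H : SimpleGraph W} {X Y : W → Fin k}

theorem alternatingGraph_comm (H : SimpleGraph W) (σ : W → Fin k) (a b : Fin k) :
    alternatingGraph H σ a b = alternatingGraph H σ b a := by
  ext u w
  simp only [alternatingGraph]
  tauto

theorem mem_cluster_iff {u w : W} {e : Fin k} (he : e ≠ X u) :
    w ∈ cluster H X u e ↔ (alternatingGraph H X (X u) e).Reachable u w := by
  simp [cluster, he]

theorem self_mem_cluster (u : W) (e : Fin k) : u ∈ cluster H X u e := by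
  by_cases he : e = X u
  · simp [cluster, he]
  · exact (mem_cluster_iff he).2 (SimpleGraph.Reachable.refl _)

theorem color_of_mem_cluster {u w : W} {e : Fin k} (hw : w ∈ cluster H X u e) :
    X w = X u ∨ X w = e := by
  by_cases he : e = X u
  · simp only [cluster, he, if_true] at hw
    exact Or.inl (congrArg X hw)
  · rw [mem_cluster_iff he, SimpleGraph.reachable_iff_reflTransGen] at hw
    induction hw with
    | refl => exact Or.inl rfl
    | tail _ h _ => exact h.2.elim (fun h => Or.inr h.2) (fun h => Or.inl h.2)

/-- The partner color of a member of a cluster, i.e. the one among the two colors of the cluster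
that it does not have, is different from its own color. -/
theorem swap_ne_of_mem_cluster {u w : W} {e : Fin k} (he : e ≠ X u)
    (hw : w ∈ cluster H X u e) : Equiv.swap (X u) e (X w) ≠ X w := by
  rcases color_of_mem_cluster hw with h | h
  · rw [h, Equiv.swap_apply_left]; exact he
  · rw [h, Equiv.swap_apply_right]; exact he.symm

theorem swap_swap_of_mem_cluster {u w : W} {e : Fin k} (hw : w ∈ cluster H X u e) :
    Equiv.swap (X w) (Equiv.swap (X u) e (X w)) = Equiv.swap (X u) e := by
  rcases color_of_mem_cluster hw with h | h
  · rw [h, Equiv.swap_apply_left]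
  · rw [h, Equiv.swap_apply_right, Equiv.swap_comm]

/-- A cluster is the same when it is grown from any other of its members. -/
theorem cluster_eq_of_mem {u w : W} {e : Fin k} (he : e ≠ X u) (hw : w ∈ cluster H X u e) :
    cluster H X w (Equiv.swap (X u) e (X w)) = cluster H X u e := by
  have hne := swap_ne_of_mem_cluster he hw
  have hgraph : alternatingGraph H X (X w) (Equiv.swap (X u) e (X w))
      = alternatingGraph H X (X u) e := by
    rcases color_of_mem_cluster hw with h | h
    · rw [h, Equiv.swap_apply_left]
    · rw [h, Equiv.swap_apply_right, alternatingGraph_comm]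
  ext z
  rw [mem_cluster_iff hne, mem_cluster_iff he, hgraph]
  rw [mem_cluster_iff he] at hw
  exact ⟨hw.trans, hw.symm.trans⟩

theorem flipCluster_eq_of_mem {u w : W} {e : Fin k} (he : e ≠ X u)
    (hw : w ∈ cluster H X u e) :
    flipCluster H X w (Equiv.swap (X u) e (X w)) = flipCluster H X u e := by
  unfold flipCluster
  rw [cluster_eq_of_mem he hw, swap_swap_of_mem_cluster hw]

/-- Flipping with the current color of the site does nothing. -/
theorem flipCluster_self (H : SimpleGraph W) (X : W → Fin k) (u : W) :
    flipCluster H X u (X u) = X := by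
  funext w
  simp [flipCluster]

/-- A cluster that avoids the site of disagreement is contained in the cluster grown from the same
site in the other coloring. -/
theorem cluster_subset_of_notMem {u v : W} {e : Fin k} (hXY : ∀ z, z ≠ v → X z = Y z)
    (hv : v ∉ cluster H X u e) : cluster H X u e ⊆ cluster H Y u e := by
  have huv : u ≠ v := fun h => hv (h ▸ self_mem_cluster u e)
  by_cases he : e = X u
  · intro w hw
    simp only [cluster, he, if_true] at hw
    rw [hw]; exact self_mem_cluster u e
  have heY : e ≠ Y u := by rwa [← hXY u huv]
  intro w hw
  rw [mem_cluster_iff he, SimpleGraph.reachable_iff_reflTransGen] at hw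
  induction hw with
  | refl => exact self_mem_cluster u e
  | @tail y z hy hyz ih =>
    have hymem : y ∈ cluster H X u e := by
      rwa [mem_cluster_iff he, SimpleGraph.reachable_iff_reflTransGen]
    have hzmem : z ∈ cluster H X u e := by
      rw [mem_cluster_iff he, SimpleGraph.reachable_iff_reflTransGen]
      exact hy.tail hyz
    have hyv : y ≠ v := fun h => hv (h ▸ hymem)
    have hzv : z ≠ v := fun h => hv (h ▸ hzmem)
    rw [mem_cluster_iff heY] at ih ⊢
    refine ih.trans (SimpleGraph.Adj.reachable ?_)
    refine ⟨hyz.1, ?_⟩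
    rw [← hXY y hyv, ← hXY z hzv, ← hXY u huv]
    exact hyz.2

theorem cluster_eq_of_notMem {u v : W} {e : Fin k} (hXY : ∀ z, z ≠ v → X z = Y z)
    (hvX : v ∉ cluster H X u e) (hvY : v ∉ cluster H Y u e) :
    cluster H X u e = cluster H Y u e :=
  (cluster_subset_of_notMem hXY hvX).antisymm
    (cluster_subset_of_notMem (fun z hz => (hXY z hz).symm) hvY)

/-- Every member `w ≠ v` of the cluster of `v` in `Y` hangs off a neighbor `u` of `v` with the
second color, in the sense that `u` lies in the cluster of `w` in `X`. -/
theorem exists_adj_mem_cluster {v w : W} {c : Fin k} (hXY : ∀ z, z ≠ v → X z = Y z)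
    (hc : c ≠ Y v) (hw : w ∈ cluster H Y v c) (hwv : w ≠ v) :
    ∃ u, H.Adj v u ∧ Y u = c ∧ u ∈ cluster H X w (Equiv.swap (Y v) c (Y w)) := by
  have key : ∀ w, Relation.ReflTransGen (alternatingGraph H Y (Y v) c).Adj v w → w ≠ v →
      ∃ u, H.Adj v u ∧ Y u = c ∧ (alternatingGraph H X (Y v) c).Reachable u w := by
    intro w hw
    induction hw with
    | refl => exact fun h => absurd rfl h
    | @tail y z hy hyz ih =>
      intro hzv
      by_cases hyv : y = v
      · subst hyv
        refine ⟨z, hyz.1, ?_, SimpleGraph.Reachable.refl _⟩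
        rcases hyz.2 with h | h
        · exact h.2
        · exact absurd h.1.symm hc
      · obtain ⟨u, h1, h2, h3⟩ := ih hyv
        refine ⟨u, h1, h2, h3.trans (SimpleGraph.Adj.reachable ⟨hyz.1, ?_⟩)⟩
        rw [hXY y hyv, hXY z hzv]
        exact hyz.2
  have hne := swap_ne_of_mem_cluster hc hw
  have hcol := color_of_mem_cluster hw
  rw [mem_cluster_iff hc, SimpleGraph.reachable_iff_reflTransGen] at hw
  obtain ⟨u, h1, h2, h3⟩ := key w hw hwv
  refine ⟨u, h1, h2, ?_⟩
  rw [← hXY w hwv] at hne hcol ⊢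
  rw [mem_cluster_iff hne]
  convert h3.symm using 1
  rcases hcol with h | h
  · rw [h, Equiv.swap_apply_left]
  · rw [h, Equiv.swap_apply_right, alternatingGraph_comm]

end

section
variable {W : Type*} [Fintype W] {k : ℕ} {H : SimpleGraph W} {X Y : W → Fin k}

open Classical in
/-- The cluster `S_σ(v, c)` as a finset. -/
noncomputable def clusterFinset (H : SimpleGraph W) (σ : W → Fin k) (v : W) (c : Fin k) :
    Finset W :=
  Finset.univ.filter (· ∈ cluster H σ v c)

@[simp]
theorem mem_clusterFinset {u w : W} {e : Fin k} :
    w ∈ clusterFinset H X u e ↔ w ∈ cluster H X u e := by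
  simp [clusterFinset]

theorem ncard_cluster (u : W) (e : Fin k) :
    (cluster H X u e).ncard = (clusterFinset H X u e).card := by
  rw [← Set.ncard_coe_finset]
  congr 1
  ext w
  simp

theorem clusterFinset_congr {H' : SimpleGraph W} {u u' : W} {e e' : Fin k}
    (h : cluster H X u e = cluster H' Y u' e') :
    clusterFinset H X u e = clusterFinset H' Y u' e' := by
  ext w
  rw [mem_clusterFinset, mem_clusterFinset, h]

/-- The rate `p_s / s`, with `s` the size of `S_σ(v, c)`, at which a chosen cluster is flipped. -/
noncomputable def flipRate (H : SimpleGraph W) (p : ℕ → ℝ) (σ : W → Fin k) (v : W) (c : Fin k) :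
    ℝ :=
  p (clusterFinset H σ v c).card / ((clusterFinset H σ v c).card : ℝ)

/-- The total rate at which one and the same cluster `S` is flipped is `p_{|S|}`. -/
theorem sum_flipRate_cluster (p : ℕ → ℝ) (g : (W → Fin k) → ℝ) {v : W} {c : Fin k}
    (hc : c ≠ X v) :
    ∑ w ∈ clusterFinset H X v c, flipRate H p X w (Equiv.swap (X v) c (X w)) *
        g (flipCluster H X w (Equiv.swap (X v) c (X w))) =
      p (clusterFinset H X v c).card * g (flipCluster H X v c) := by
  have hpos : (0 : ℝ) < (clusterFinset H X v c).card := by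
    exact_mod_cast Finset.card_pos.2 ⟨v, mem_clusterFinset.2 (self_mem_cluster v c)⟩
  have : ∀ w ∈ clusterFinset H X v c, flipRate H p X w (Equiv.swap (X v) c (X w)) *
      g (flipCluster H X w (Equiv.swap (X v) c (X w))) =
      p (clusterFinset H X v c).card / (clusterFinset H X v c).card * g (flipCluster H X v c) := by
    intro w hw
    rw [mem_clusterFinset] at hw
    rw [flipRate, clusterFinset_congr (cluster_eq_of_mem hc hw), flipCluster_eq_of_mem hc hw]
  rw [Finset.sum_congr rfl this, Finset.sum_const, nsmul_eq_mul]
  field_simp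

variable [DecidableEq W]

/-- Interchange the colors `a` and `b` on the set `B`. -/
def swapOn {W : Type*} [DecidableEq W] {k : ℕ} (σ : W → Fin k) (B : Finset W) (a b : Fin k) :
    W → Fin k :=
  fun w => if w ∈ B then Equiv.swap a b (σ w) else σ w

theorem swapOn_of_notMem {W : Type*} [DecidableEq W] {k : ℕ} {σ : W → Fin k} {B : Finset W}
    (a b : Fin k) {u : W} (h : u ∉ B) :
    swapOn σ B a b u = σ u := if_neg h

theorem swapOn_of_mem {W : Type*} [DecidableEq W] {k : ℕ} {σ : W → Fin k} {B : Finset W}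
    (a b : Fin k) {u : W} (h : u ∈ B) :
    swapOn σ B a b u = Equiv.swap a b (σ u) := if_pos h

theorem flipCluster_eq_swapOn (u : W) (e : Fin k) :
    flipCluster H X u e = swapOn X (clusterFinset H X u e) (X u) e := by
  funext w
  by_cases h : w ∈ cluster H X u e <;> simp [flipCluster, swapOn, h]

theorem flipMatrix_mulVec [Nonempty W] (p : ℕ → ℝ) (hk : 0 < k)
    (f : (W → Fin k) → ℝ) (σ : W → Fin k) :
    (Fintype.card W * k : ℝ) * (flipMatrix H p k).mulVec f σ =
      (Fintype.card W * k : ℝ) * f σ +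
      ∑ q : W × Fin k, flipRate H p σ q.1 q.2 * (f (flipCluster H σ q.1 q.2) - f σ) := by
  have hN : (Fintype.card W * k : ℝ) ≠ 0 := by
    have := Fintype.card_pos (α := W)
    positivity
  have h1 : (flipMatrix H p k).mulVec f σ = (1 / ((Fintype.card W : ℝ) * (k : ℝ))) *
      ∑ v : W, ∑ c : Fin k, (flipRate H p σ v c * f (flipCluster H σ v c) +
        (1 - flipRate H p σ v c) * f σ) := by
    simp only [Matrix.mulVec, dotProduct, flipMatrix, mul_assoc, ← Finset.mul_sum, ncard_cluster]
    congr 1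
    simp only [Finset.sum_mul]
    rw [Finset.sum_comm]
    refine Finset.sum_congr rfl fun v _ => ?_
    rw [Finset.sum_comm]
    refine Finset.sum_congr rfl fun c _ => ?_
    simp only [add_mul, Finset.sum_add_distrib, mul_assoc, ← Finset.mul_sum, ite_mul, one_mul,
      zero_mul, Finset.sum_ite_eq, Finset.mem_univ, if_true, flipRate]
  rw [h1, ← mul_assoc, mul_one_div_cancel hN, one_mul, Fintype.sum_prod_type]
  have h2 : (Fintype.card W * k : ℝ) * f σ = ∑ _v : W, ∑ _c : Fin k, f σ := by
    simp [mul_assoc]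
  rw [h2, ← Finset.sum_add_distrib]
  refine Finset.sum_congr rfl fun v _ => ?_
  rw [← Finset.sum_add_distrib]
  exact Finset.sum_congr rfl fun c _ => by ring

/-- The pairs whose cluster contains `v`, reorganized by the second color `c` of the cluster. -/
theorem sum_pairs_mem_cluster (v : W) (F : W → Fin k → ℝ) :
    ∑ q : W × Fin k with q.2 ≠ X q.1 ∧ v ∈ clusterFinset H X q.1 q.2, F q.1 q.2 =
      ∑ c with c ≠ X v, ∑ w ∈ clusterFinset H X v c, F w (Equiv.swap (X v) c (X w)) := by
  rw [Finset.sum_sigma']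
  refine Finset.sum_nbij' (fun q => ⟨Equiv.swap (X q.1) q.2 (X v), q.1⟩)
    (fun s => (s.2, Equiv.swap (X v) s.1 (X s.2))) ?_ ?_ ?_ ?_ ?_
  · rintro ⟨u, e⟩ hq
    simp only [Finset.mem_filter, Finset.mem_univ, true_and, mem_clusterFinset] at hq
    simp only [Finset.mem_sigma, Finset.mem_filter, Finset.mem_univ, true_and, mem_clusterFinset]
    exact ⟨swap_ne_of_mem_cluster hq.1 hq.2, by
      rw [cluster_eq_of_mem hq.1 hq.2]; exact self_mem_cluster u e⟩
  · rintro ⟨c, w⟩ hs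
    simp only [Finset.mem_sigma, Finset.mem_filter, Finset.mem_univ, true_and,
      mem_clusterFinset] at hs
    simp only [Finset.mem_filter, Finset.mem_univ, true_and, mem_clusterFinset]
    exact ⟨swap_ne_of_mem_cluster hs.1 hs.2, by
      rw [cluster_eq_of_mem hs.1 hs.2]; exact self_mem_cluster v c⟩
  · rintro ⟨u, e⟩ hq
    simp only [Finset.mem_filter, Finset.mem_univ, true_and, mem_clusterFinset] at hq
    simp only [Prod.mk.injEq, true_and]
    rw [swap_swap_of_mem_cluster hq.2, Equiv.swap_apply_left]
  · rintro ⟨c, w⟩ hs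
    simp only [Finset.mem_sigma, Finset.mem_filter, Finset.mem_univ, true_and,
      mem_clusterFinset] at hs
    simp only [Sigma.mk.injEq, heq_eq_eq, and_true]
    rw [swap_swap_of_mem_cluster hs.2, Equiv.swap_apply_left]
  · rintro ⟨u, e⟩ hq
    simp only [Finset.mem_filter, Finset.mem_univ, true_and, mem_clusterFinset] at hq
    simp only
    rw [swap_swap_of_mem_cluster hq.2, Equiv.swap_apply_left]

/-- A decomposition of the cluster `S_Y(v, c)`. Let `X` and `Y` differ at most at `v`. The clusters
of `X` inside `S_Y(v, c)` that avoid `v` are indexed by the neighbors `i` of `v` that have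
color `c` and represent them: `block i` is the cluster represented by `i`, and it is empty if `i`
represents no cluster, either because another neighbor in the same cluster does or because the
cluster contains `v`. Empty blocks contribute nothing to `sum_eq` because of `p 0 = 0`. -/
structure IsBlockDecomposition (H : SimpleGraph W) (X Y : W → Fin k) (v : W) (c : Fin k)
    (I : Finset W) (block : W → Finset W) : Prop where
  subset : ∀ i, block i ⊆ (clusterFinset H Y v c).erase v
  disjoint : ∀ i j, i ≠ j → Disjoint (block i) (block j)
  rep_mem : ∀ i, (block i).Nonempty → i ∈ block i
  sum_eq : ∀ (p : ℕ → ℝ) (g : (W → Fin k) → ℝ), p 0 = 0 →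
    ∑ w ∈ clusterFinset H Y v c,
      (if v ∉ clusterFinset H X w (Equiv.swap (Y v) c (Y w)) then
        flipRate H p X w (Equiv.swap (Y v) c (Y w)) *
          g (flipCluster H X w (Equiv.swap (Y v) c (Y w))) else 0) =
      ∑ i ∈ I, p (block i).card * g (swapOn X (block i) (Y v) c)
  biUnion : X v ≠ Y v → c ≠ X v → (clusterFinset H Y v c).erase v = I.biUnion block
  single : ∀ u, I = {u} → (block u).Nonempty → block u = (clusterFinset H Y v c).erase v
  empty : I = ∅ → clusterFinset H Y v c = {v}

/-- Existence of the decomposition, by a choice of a neighbor of `v` with color `c` in each cluster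
of `X` that contains one. -/
theorem exists_isBlockDecomposition {v : W} {c : Fin k} (hXY : ∀ z, z ≠ v → X z = Y z)
    (hc : c ≠ Y v) {I : Finset W} (hI : ∀ u, u ∈ I ↔ H.Adj v u ∧ Y u = c) :
    ∃ block, IsBlockDecomposition H X Y v c I block := by
  set S := clusterFinset H Y v c with hS
  set T : W → Finset W := fun w => clusterFinset H X w (Equiv.swap (Y v) c (Y w)) with hT
  set rep : Finset W → W := fun A => if h : (A ∩ I).Nonempty then h.choose else v with hrep
  have hrep_mem : ∀ A, (A ∩ I).Nonempty → rep A ∈ A ∧ rep A ∈ I := by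
    intro A h
    have : rep A = h.choose := dif_pos h
    rw [this]
    exact Finset.mem_inter.1 h.choose_spec
  have hself : ∀ w, w ∈ T w := fun w => mem_clusterFinset.2 (self_mem_cluster _ _)
  have hne_v : ∀ w, v ∉ T w → w ≠ v := fun w h h' => h (h' ▸ hself v)
  have hnonempty : ∀ w ∈ S, w ≠ v → (T w ∩ I).Nonempty := by
    intro w hw hwv
    obtain ⟨u, h1, h2, h3⟩ := exists_adj_mem_cluster hXY hc (mem_clusterFinset.1 hw) hwv
    exact ⟨u, Finset.mem_inter.2 ⟨mem_clusterFinset.2 h3, (hI u).2 ⟨h1, h2⟩⟩⟩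
  -- `T w` is the cluster of `X` grown from `w` with the two colors of the cluster `S`
  have hTS : ∀ w ∈ S, v ∉ T w → T w ⊆ S := by
    intro w hw hv z hz
    have h1 := cluster_subset_of_notMem (H := H) hXY (fun h => hv (mem_clusterFinset.2 h))
      (mem_clusterFinset.1 hz)
    rw [cluster_eq_of_mem hc (mem_clusterFinset.1 hw)] at h1
    exact mem_clusterFinset.2 h1
  have hne : ∀ w ∈ S, w ≠ v → Equiv.swap (Y v) c (Y w) ≠ X w := by
    intro w hw hwv
    rw [hXY w hwv]
    exact swap_ne_of_mem_cluster hc (mem_clusterFinset.1 hw)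
  have hpartner : ∀ w ∈ S, v ∉ T w → ∀ z ∈ T w,
      Equiv.swap (X w) (Equiv.swap (Y v) c (Y w)) (X z) = Equiv.swap (Y v) c (Y z) := by
    intro w hw hv z hz
    have hzv : z ≠ v := fun h => hv (h ▸ hz)
    rw [hXY w (hne_v w hv), swap_swap_of_mem_cluster (mem_clusterFinset.1 hw), hXY z hzv]
  have hTeq : ∀ w ∈ S, v ∉ T w → ∀ z ∈ T w, T z = T w := by
    intro w hw hv z hz
    have h1 := cluster_eq_of_mem (hne w hw (hne_v w hv)) (mem_clusterFinset.1 hz)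
    rw [hpartner w hw hv z hz] at h1
    exact clusterFinset_congr h1
  have hflip : ∀ w ∈ S, v ∉ T w → flipCluster H X w (Equiv.swap (Y v) c (Y w)) =
      swapOn X (T w) (Y v) c := by
    intro w hw hv
    rw [flipCluster_eq_swapOn]
    unfold swapOn
    rw [hXY w (hne_v w hv), swap_swap_of_mem_cluster (mem_clusterFinset.1 hw)]
  clear_value rep
  -- a member of `S` belongs to the block of the representative of its cluster in `X`
  obtain ⟨block, hblock⟩ : ∃ block : W → Finset W,
      ∀ i, block i = S.filter (fun w => v ∉ T w ∧ rep (T w) = i) := ⟨_, fun _ => rfl⟩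
  have hmem : ∀ {i w}, w ∈ block i ↔ w ∈ S ∧ v ∉ T w ∧ rep (T w) = i := by
    intro i w
    rw [hblock, Finset.mem_filter]
  have hblockT : ∀ i, ∀ w ∈ block i, i ∈ T w ∧ block i = T w := by
    intro i w hw
    rw [hmem] at hw
    obtain ⟨hwS, hvw, hri⟩ := hw
    have hi := (hrep_mem _ (hnonempty w hwS (hne_v w hvw))).1
    rw [hri] at hi
    refine ⟨hi, ?_⟩
    ext z
    rw [hmem]
    constructor
    · rintro ⟨hzS, hvz, hrz⟩
      have hi' := (hrep_mem _ (hnonempty z hzS (hne_v z hvz))).1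
      rw [hrz] at hi'
      rw [← hTeq w hwS hvw i hi, hTeq z hzS hvz i hi']
      exact hself z
    · intro hz
      rw [hTeq w hwS hvw z hz]
      exact ⟨hTS w hwS hvw hz, hvw, hri⟩
  refine ⟨block, ?_, ?_, ?_, ?_, ?_, ?_, ?_⟩
  · intro i w hw
    rw [hmem] at hw
    exact Finset.mem_erase.2 ⟨hne_v w hw.2.1, hw.1⟩
  · intro i j hij
    refine Finset.disjoint_left.2 fun w hi hj => hij ?_
    rw [hmem] at hi hj
    exact hi.2.2.symm.trans hj.2.2
  · rintro i ⟨w, hw⟩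
    obtain ⟨h1, h2⟩ := hblockT i w hw
    rwa [h2]
  · intro p g hp
    rw [← Finset.sum_filter]
    have hmaps : ∀ w ∈ S.filter (fun w => v ∉ T w), rep (T w) ∈ I := by
      intro w hw
      rw [Finset.mem_filter] at hw
      exact (hrep_mem _ (hnonempty w hw.1 (hne_v w hw.2))).2
    rw [← Finset.sum_fiberwise_of_maps_to hmaps]
    refine Finset.sum_congr rfl fun i _ => ?_
    rw [Finset.filter_filter, ← hblock]
    have hterm : ∀ w ∈ block i, flipRate H p X w (Equiv.swap (Y v) c (Y w)) *
        g (flipCluster H X w (Equiv.swap (Y v) c (Y w))) =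
        p (block i).card / (block i).card * g (swapOn X (block i) (Y v) c) := by
      intro w hw
      have h2 := (hblockT i w hw).2
      rw [hmem] at hw
      rw [hflip w hw.1 hw.2.1, h2, flipRate]
    rw [Finset.sum_congr rfl hterm, Finset.sum_const, nsmul_eq_mul]
    rcases (block i).eq_empty_or_nonempty with h | h
    · simp [h, hp]
    · have : (0 : ℝ) < (block i).card := by exact_mod_cast Finset.card_pos.2 h
      rw [← mul_assoc, mul_div_cancel₀ _ this.ne']
  · intro hne' hcX
    ext w
    simp only [Finset.mem_biUnion, Finset.mem_erase]
    constructor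
    · rintro ⟨hwv, hw⟩
      have hv : v ∉ T w := by
        intro h
        have h1 := color_of_mem_cluster (mem_clusterFinset.1 h)
        rw [hXY w hwv] at h1
        rcases color_of_mem_cluster (mem_clusterFinset.1 hw) with h' | h'
        · rw [h', Equiv.swap_apply_left] at h1
          exact h1.elim hne' hcX.symm
        · rw [h', Equiv.swap_apply_right] at h1
          exact h1.elim hcX.symm hne'
      exact ⟨rep (T w), (hrep_mem _ (hnonempty w hw hwv)).2,
        hmem.2 ⟨hw, hv, rfl⟩⟩
    · rintro ⟨i, _, hw⟩
      rw [hmem] at hw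
      exact ⟨hne_v w hw.2.1, hw.1⟩
  · rintro u hu ⟨w, hw⟩
    have h2 := (hblockT u w hw).2
    have hw' := hw
    rw [hmem] at hw'
    ext z
    rw [Finset.mem_erase]
    constructor
    · intro hz
      rw [hmem] at hz
      exact ⟨hne_v z hz.2.1, hz.1⟩
    · rintro ⟨hzv, hz⟩
      obtain ⟨u', h3, h4, h5⟩ := exists_adj_mem_cluster hXY hc (mem_clusterFinset.1 hz) hzv
      have hu' : u' = u := by
        have := (hI u').2 ⟨h3, h4⟩
        rwa [hu, Finset.mem_singleton] at this
      rw [hu'] at h5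
      have hzT := cluster_eq_of_mem (hne z hz hzv) h5
      have huT := hTeq w hw'.1 hw'.2.1 u (hblockT u w hw).1
      have huv : u ≠ v := by
        rintro rfl
        exact hw'.2.1 (hblockT u w hw).1
      rw [hXY z hzv, swap_swap_of_mem_cluster (mem_clusterFinset.1 hz), hXY u huv] at hzT
      rw [h2, ← huT, mem_clusterFinset, hzT]
      exact self_mem_cluster _ _
  · intro hempty
    ext w
    rw [Finset.mem_singleton]
    constructor
    · intro hw
      by_contra hwv
      obtain ⟨u, hu⟩ := hnonempty w hw hwv
      rw [hempty] at hu
      simp at hu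
    · rintro rfl
      exact mem_clusterFinset.2 (self_mem_cluster _ _)

end

/-! ### Numerical properties of the flip probabilities -/

theorem flipProb_eq_zero {n : ℕ} (h : 7 ≤ n) : flipProb n = 0 := by
  obtain ⟨m, rfl⟩ := Nat.exists_eq_add_of_le' h
  rfl

theorem flipProb_zero : flipProb 0 = 0 := rfl

theorem flipProb_one : flipProb 1 = 1 := rfl

theorem flipProb_nonneg (n : ℕ) : 0 ≤ flipProb n := by
  rcases Nat.lt_or_ge n 7 with h | h
  · interval_cases n <;> norm_num [flipProb]
  · rw [flipProb_eq_zero h]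

theorem flipProb_le_one (n : ℕ) : flipProb n ≤ 1 := by
  rcases Nat.lt_or_ge n 7 with h | h
  · interval_cases n <;> norm_num [flipProb]
  · rw [flipProb_eq_zero h]; norm_num

theorem flipProb_anti {m n : ℕ} (hm : 1 ≤ m) (hmn : m ≤ n) : flipProb n ≤ flipProb m := by
  induction n, hmn using Nat.le_induction with
  | base => exact le_rfl
  | succ n hn ih =>
    refine le_trans ?_ ih
    rcases Nat.lt_or_ge n 7 with h | h
    · have : 1 ≤ n := hm.trans hn
      interval_cases n <;> norm_num [flipProb]
    · rw [flipProb_eq_zero h, flipProb_eq_zero (by omega)]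

theorem flipProb_le_of_two_le {n : ℕ} (h : 2 ≤ n) : flipProb n ≤ 137 / 650 :=
  flipProb_anti (by norm_num) h

theorem sub_one_mul_flipProb_le (n : ℕ) : ((n : ℝ) - 1) * flipProb n ≤ 154 / 650 := by
  rcases Nat.lt_or_ge n 7 with h | h
  · interval_cases n <;> norm_num [flipProb]
  · rw [flipProb_eq_zero h]; norm_num

theorem mul_flipProb_le_one (n : ℕ) : (n : ℝ) * flipProb n ≤ 1 := by
  rcases Nat.lt_or_ge n 7 with h | h
  · interval_cases n <;> norm_num [flipProb]
  · rw [flipProb_eq_zero h]; norm_num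

theorem mul_flipProb_le_of_two_le {n : ℕ} (hn : 2 ≤ n) : (n : ℝ) * flipProb n ≤ 274 / 650 := by
  rcases Nat.lt_or_ge n 7 with h | h
  · interval_cases n <;> norm_num [flipProb]
  · rw [flipProb_eq_zero h]; norm_num

/-- The flip probabilities are chosen so that `(n - 1) (P_n - P_{n+1})` is constant for
`2 ≤ n ≤ 6`. -/
theorem sub_one_mul_flipProb_sub_le {n : ℕ} (hn : 1 ≤ n) :
    ((n : ℝ) - 1) * (flipProb n - flipProb (n + 1)) ≤ 60 / 650 := by
  rcases Nat.lt_or_ge n 7 with h | h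
  · interval_cases n <;> norm_num [flipProb]
  · rw [flipProb_eq_zero h, flipProb_eq_zero (by omega)]; norm_num

theorem flipProb_sub_le_of_two_le {n : ℕ} (hn : 2 ≤ n) :
    flipProb n - flipProb (n + 1) ≤ 60 / 650 := by
  rcases Nat.lt_or_ge n 7 with h | h
  · interval_cases n <;> norm_num [flipProb]
  · rw [flipProb_eq_zero h, flipProb_eq_zero (by omega)]; norm_num

theorem flipProb_sub_le {n : ℕ} (hn : 1 ≤ n) :
    flipProb n - flipProb (n + 1) ≤ 513 / 650 := by
  rcases hn.eq_or_lt with rfl | h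
  · norm_num [flipProb]
  · exact (flipProb_sub_le_of_two_le h).trans (by norm_num)

theorem flipProb_mul_le {m s : ℕ} (hm : 1 ≤ m) :
    flipProb (1 + (m + s)) * s ≤ 94 / 650 := by
  rcases Nat.lt_or_ge (1 + (m + s)) 7 with h | h
  · have h1 : m < 6 := by omega
    have h2 : s < 6 := by omega
    interval_cases m <;> interval_cases s <;> first | omega | norm_num [flipProb]
  · rw [flipProb_eq_zero h]; norm_num

theorem flipProb_mul_le_of_two_le {m s : ℕ} (hm : 2 ≤ m) :
    flipProb (1 + (m + s)) * s ≤ 54 / 650 := by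
  rcases Nat.lt_or_ge (1 + (m + s)) 7 with h | h
  · have h1 : m < 6 := by omega
    have h2 : s < 6 := by omega
    interval_cases m <;> interval_cases s <;> first | omega | norm_num [flipProb]
  · rw [flipProb_eq_zero h]; norm_num

/-- For a color with two blocks of sizes `n ≤ m`: half of what one side adds to `couplingCost` when
all weights are `2`, without the maxima of rates. The block of size `m` is the one coupled to the
large cluster, whose size is `1 + (m + n)`. -/
noncomputable def pairCost (m n : ℕ) : ℝ :=
  (m - 1) * (flipProb m - flipProb (1 + (m + n))) + (n - 1) * flipProb n +
    n * flipProb (1 + (m + n))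

/-- The bounds needed for the four ways to distribute the two maxima of rates over the two sides.
The first one is sharp at `m = n = 3`. -/
theorem pairCost_bounds {m n : ℕ} (hm : 1 ≤ m) (hnm : n ≤ m) :
    pairCost m n ≤ 308 / 650 ∧
    pairCost m n + (flipProb m - flipProb (1 + (m + n))) ≤ 1 ∧
    pairCost m n + flipProb n ≤ 787 / 650 ∧
    pairCost m n + (flipProb m - flipProb (1 + (m + n))) + flipProb n ≤ 2 := by
  rcases Nat.lt_or_ge m 7 with h | h
  · have h2 : n < 7 := by omega
    unfold pairCost
    rcases Nat.lt_or_ge (1 + (m + n)) 7 with h3 | h3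
    · interval_cases m <;> interval_cases n <;> first | omega | norm_num [flipProb]
    · rw [flipProb_eq_zero h3]
      interval_cases m <;> interval_cases n <;> first | omega | norm_num [flipProb]
  · have h1 := sub_one_mul_flipProb_le n
    have h2 := mul_flipProb_le_one n
    have h3 := flipProb_le_one n
    unfold pairCost
    rw [flipProb_eq_zero h, flipProb_eq_zero (by omega : 7 ≤ 1 + (m + n))]
    refine ⟨?_, ?_, ?_, ?_⟩ <;> linarith

section
variable {ι : Type*} [DecidableEq ι] {I : Finset ι}

/-- The rate at which block `i`, of size `a i`, is flipped outside the coupling with the large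
cluster. The latter has size `1 + ∑ a` and is coupled to block `im`. -/
noncomputable def residualRate (I : Finset ι) (a : ι → ℕ) (im i : ι) : ℝ :=
  flipProb (a i) - if i = im then flipProb (1 + ∑ j ∈ I, a j) else 0

theorem residualRate_le (a : ι → ℕ) (im i : ι) : residualRate I a im i ≤ flipProb (a i) := by
  have := flipProb_nonneg (1 + ∑ j ∈ I, a j)
  unfold residualRate
  split_ifs <;> linarith

theorem residualRate_nonneg (a : ι → ℕ) {im : ι} (him : im ∈ I) (ha : 1 ≤ a im) (i : ι) :
    0 ≤ residualRate I a im i := by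
  unfold residualRate
  split_ifs with h
  · subst h
    have h1 : a i ≤ ∑ j ∈ I, a j := Finset.single_le_sum (fun _ _ => Nat.zero_le _) him
    have := flipProb_anti ha (show a i ≤ 1 + ∑ j ∈ I, a j by omega)
    linarith
  · have := flipProb_nonneg (a i)
    linarith

theorem residualRate_eq_zero (a : ι → ℕ) {im : ι} (ha : 1 ≤ a im) {i : ι} (hi : a i = 0) :
    residualRate I a im i = 0 := by
  have : i ≠ im := by rintro rfl; omega
  rw [residualRate, if_neg this, hi, flipProb_zero, sub_zero]

/-- The weight of the blocks other than the coupled one, times the rate of the large cluster. -/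
theorem coupled_cost_le (a : ι → ℕ) {im : ι} (him : im ∈ I) (ha : 1 ≤ a im) :
    flipProb (1 + ∑ j ∈ I, a j) * ∑ j ∈ I.erase im, (a j : ℝ) ≤ 94 / 650 := by
  have h1 := Finset.add_sum_erase I a him
  rw [← h1]
  have := flipProb_mul_le (s := ∑ j ∈ I.erase im, a j) ha
  push_cast at this
  exact this

theorem coupled_cost_le_of_two_le (a : ι → ℕ) {im : ι} (him : im ∈ I) (ha : 2 ≤ a im) :
    flipProb (1 + ∑ j ∈ I, a j) * ∑ j ∈ I.erase im, (a j : ℝ) ≤ 54 / 650 := by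
  have h1 := Finset.add_sum_erase I a him
  rw [← h1]
  have := flipProb_mul_le_of_two_le (s := ∑ j ∈ I.erase im, a j) ha
  push_cast at this
  exact this

/-- A bound for `(a i - 1)` times the residual rate by the full rate. -/
theorem sub_one_mul_residualRate_le (a : ι → ℕ) {im : ι} (ha : 1 ≤ a im) (i : ι) :
    ((a i : ℝ) - 1) * residualRate I a im i ≤ ((a i : ℝ) - 1) * flipProb (a i) := by
  rcases Nat.eq_zero_or_pos (a i) with h | h
  · rw [residualRate_eq_zero a ha h, h, flipProb_zero]
  · have h1 : (1 : ℝ) ≤ a i := by exact_mod_cast h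
    exact mul_le_mul_of_nonneg_left (residualRate_le a im i) (by linarith)

/-- Cost of one index when the two residual rates are estimated by the full rates. -/
theorem index_cost_le (a b : ι → ℕ) {im jm : ι} (ha : 1 ≤ a im) (hb : 1 ≤ b jm) {w : ℝ}
    (hw : w = 1 ∨ w = 2) (i : ι) :
    2 * ((a i : ℝ) - 1) * residualRate I a im i + 2 * ((b i : ℝ) - 1) * residualRate I b jm i +
      w * max (residualRate I a im i) (residualRate I b jm i) ≤ w + 308 / 650 := by
  have h1 := sub_one_mul_residualRate_le (I := I) a ha i
  have h2 := sub_one_mul_residualRate_le (I := I) b hb i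
  have h3 := sub_one_mul_flipProb_le (a i)
  have h4 := sub_one_mul_flipProb_le (b i)
  have h5 := residualRate_le (I := I) a im i
  have h6 := residualRate_le (I := I) b jm i
  have small : ∀ n : ℕ, n ≤ 1 → ((n : ℝ) - 1) * flipProb n ≤ 0 := by
    intro n hn
    interval_cases n <;> simp [flipProb]
  by_cases hsm : a i ≤ 1 ∨ b i ≤ 1
  · have hmax : max (residualRate I a im i) (residualRate I b jm i) ≤ 1 :=
      max_le (h5.trans (flipProb_le_one _)) (h6.trans (flipProb_le_one _))
    have h8 : w * max (residualRate I a im i) (residualRate I b jm i) ≤ w := by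
      rcases hw with rfl | rfl <;> linarith
    rcases hsm with h | h
    · have := small _ h
      linarith
    · have := small _ h
      linarith
  · push Not at hsm
    have hmax : max (residualRate I a im i) (residualRate I b jm i) ≤ 137 / 650 :=
      max_le (h5.trans (flipProb_le_of_two_le hsm.1)) (h6.trans (flipProb_le_of_two_le hsm.2))
    rcases hw with rfl | rfl <;> linarith

/-- The expected cost of the coupling once the block weights have been replaced by their upper
bounds `w i + 2 (a i - 1)`. -/
noncomputable def couplingCost (I : Finset ι) (w : ι → ℝ) (a b : ι → ℕ) (im jm : ι) : ℝ :=
  2 * (flipProb (1 + ∑ j ∈ I, a j) * ∑ j ∈ I.erase im, (a j : ℝ)) +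
  2 * (flipProb (1 + ∑ j ∈ I, b j) * ∑ j ∈ I.erase jm, (b j : ℝ)) +
  ∑ i ∈ I, (2 * ((a i : ℝ) - 1) * residualRate I a im i +
    2 * ((b i : ℝ) - 1) * residualRate I b jm i +
    w i * max (residualRate I a im i) (residualRate I b jm i))

theorem couplingCost_le_card (w : ι → ℝ) (hw : ∀ i, w i = 1 ∨ w i = 2) (a b : ι → ℕ) {im jm : ι}
    (him : im ∈ I) (hjm : jm ∈ I) (ha : 1 ≤ a im) (hb : 1 ≤ b jm) :
    couplingCost I w a b im jm ≤ ∑ i ∈ I, w i + 308 / 650 * I.card + 376 / 650 := by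
  have h1 := coupled_cost_le a him ha
  have h2 := coupled_cost_le b hjm hb
  have h3 := Finset.sum_le_sum fun i (_ : i ∈ I) => index_cost_le (I := I) a b ha hb (hw i) i
  rw [Finset.sum_add_distrib (f := w), Finset.sum_const, nsmul_eq_mul] at h3
  unfold couplingCost
  linarith

/-- A color with a single neighbor. This is the case that determines the constant
`1933 / 650 = 2 + 633 / 650`. -/
theorem couplingCost_singleton_le (w : ι → ℝ) (i : ι) (hw : w i = 1 ∨ w i = 2) (a b : ι → ℕ)
    (ha : 1 ≤ a i) (hb : 1 ≤ b i) :
    couplingCost {i} w a b i i ≤ w i * (513 / 650) + 120 / 650 := by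
  have h1 := sub_one_mul_flipProb_sub_le ha
  have h2 := sub_one_mul_flipProb_sub_le hb
  have h3 := flipProb_sub_le ha
  have h4 := flipProb_sub_le hb
  simp only [couplingCost, residualRate, Finset.sum_singleton, if_true, Finset.erase_singleton,
    Finset.sum_empty, mul_zero, zero_add, add_comm 1]
  have hmax := max_le h3 h4
  have hwm : w i * max (flipProb (a i) - flipProb (a i + 1)) (flipProb (b i) - flipProb (b i + 1))
      ≤ w i * (513 / 650) :=
    mul_le_mul_of_nonneg_left hmax (by rcases hw with h | h <;> norm_num [h])
  rcases ha.eq_or_lt with h | h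
  · rw [← h] at hwm ⊢
    norm_num at hwm ⊢
    linarith
  · rcases hb.eq_or_lt with h' | h'
    · rw [← h'] at hwm ⊢
      norm_num at hwm ⊢
      linarith
    · have hmax' := max_le (flipProb_sub_le_of_two_le h) (flipProb_sub_le_of_two_le h')
      rcases hw with h'' | h'' <;> rw [h''] <;> linarith

/-- A color with two neighbors. The maximum of the two residual rates is not separable in the two
sides, so each of the four choices of maximizers is estimated separately by `pairCost_bounds`. -/
theorem couplingCost_pair_le (w : ι → ℝ) {x y : ι} (hxy : x ≠ y) (hw : ∀ i, w i ≤ 2)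
    (a b : ι → ℕ) {jm : ι} (ha : 1 ≤ a x) (hax : a y ≤ a x) (hjm : jm = x ∨ jm = y)
    (hb : 1 ≤ b jm) (hbx : b x ≤ b jm) (hby : b y ≤ b jm) :
    couplingCost {x, y} w a b x jm ≤ 3216 / 650 := by
  have hnn : ∀ i, 0 ≤ residualRate {x, y} a x i :=
    residualRate_nonneg a (by simp) ha
  -- the cost increases with the weights, so the weight `2` is the worst case
  have hcost : couplingCost {x, y} w a b x jm ≤ couplingCost {x, y} (fun _ => 2) a b x jm := by
    unfold couplingCost
    gcongr with i
    · exact le_max_of_le_left (hnn i)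
    · exact hw i
  refine hcost.trans ?_
  obtain ⟨p1, p2, p3, p4⟩ := pairCost_bounds ha hax
  have e1 : ({x, y} : Finset ι).erase x = {y} := by
    rw [Finset.erase_insert (by simpa using hxy)]
  have e2 : ({x, y} : Finset ι).erase y = {x} := by
    rw [Finset.pair_comm, Finset.erase_insert (by simpa using hxy.symm)]
  unfold couplingCost residualRate
  rcases hjm with rfl | rfl
  · obtain ⟨q1, q2, q3, q4⟩ := pairCost_bounds hb hby
    simp only [Finset.sum_pair hxy, e1, Finset.sum_singleton, if_true, if_neg hxy.symm, sub_zero]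
    unfold pairCost at *
    rcases max_cases (flipProb (a jm) - flipProb (1 + (a jm + a y)))
        (flipProb (b jm) - flipProb (1 + (b jm + b y))) with ⟨h1, -⟩ | ⟨h1, -⟩ <;>
      rcases max_cases (flipProb (a y)) (flipProb (b y)) with ⟨h2, -⟩ | ⟨h2, -⟩ <;>
      rw [h1, h2] <;> linarith
  · obtain ⟨q1, q2, q3, q4⟩ := pairCost_bounds hb hbx
    simp only [Finset.sum_pair hxy, e1, e2, Finset.sum_singleton, if_true, if_neg hxy,
      if_neg hxy.symm, sub_zero]
    rw [add_comm (b x) (b jm)]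
    unfold pairCost at *
    rcases max_cases (flipProb (a x) - flipProb (1 + (a x + a jm)))
        (flipProb (b x)) with ⟨h1, -⟩ | ⟨h1, -⟩ <;>
      rcases max_cases (flipProb (a jm)) (flipProb (b jm) - flipProb (1 + (b jm + b x)))
        with ⟨h2, -⟩ | ⟨h2, -⟩ <;>
      rw [h1, h2] <;> linarith

/-- A color with three neighbors: either all blocks are trivial, or one of the two large clusters
has a coupled block of size at least two. -/
theorem couplingCost_three_le (w : ι → ℝ) (hw : ∀ i, w i = 1 ∨ w i = 2) (hcard : I.card = 3)
    (a b : ι → ℕ) {im jm : ι} (him : im ∈ I) (hjm : jm ∈ I)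
    (ha : 1 ≤ a im) (hb : 1 ≤ b jm) (ham : ∀ i ∈ I, a i ≤ a im) (hbm : ∀ i ∈ I, b i ≤ b jm) :
    couplingCost I w a b im jm ≤ 5149 / 650 := by
  have h1 := coupled_cost_le a him ha
  have h2 := coupled_cost_le b hjm hb
  have hw2 : ∀ i, w i ≤ 2 := fun i => by rcases hw i with h | h <;> norm_num [h]
  by_cases hone : a im ≤ 1 ∧ b jm ≤ 1
  · have h3 : ∑ i ∈ I, (2 * ((a i : ℝ) - 1) * residualRate I a im i +
        2 * ((b i : ℝ) - 1) * residualRate I b jm i +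
        w i * max (residualRate I a im i) (residualRate I b jm i)) ≤ ∑ i ∈ I, 2 := by
      refine Finset.sum_le_sum fun i hi => ?_
      have ea : ((a i : ℝ) - 1) ≤ 0 := by
        have : (a i : ℝ) ≤ 1 := by exact_mod_cast (ham i hi).trans hone.1
        linarith
      have eb : ((b i : ℝ) - 1) ≤ 0 := by
        have : (b i : ℝ) ≤ 1 := by exact_mod_cast (hbm i hi).trans hone.2
        linarith
      have na := residualRate_nonneg a him ha i
      have nb := residualRate_nonneg b hjm hb i
      have ta := mul_nonpos_of_nonpos_of_nonneg ea na
      have tb := mul_nonpos_of_nonpos_of_nonneg eb nb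
      have hmax : max (residualRate I a im i) (residualRate I b jm i) ≤ 1 :=
        max_le ((residualRate_le a im i).trans (flipProb_le_one _))
          ((residualRate_le b jm i).trans (flipProb_le_one _))
      have : w i * max (residualRate I a im i) (residualRate I b jm i) ≤ 2 := by
        rcases hw i with h | h <;> rw [h] <;> linarith
      linarith
    rw [Finset.sum_const, hcard] at h3
    unfold couplingCost
    norm_num at h3 ⊢
    linarith
  · have h3 : ∑ i ∈ I, (2 * ((a i : ℝ) - 1) * residualRate I a im i +
        2 * ((b i : ℝ) - 1) * residualRate I b jm i +
        w i * max (residualRate I a im i) (residualRate I b jm i)) ≤ ∑ i ∈ I, (2 + 308 / 650) :=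
      Finset.sum_le_sum fun i _ => (index_cost_le a b ha hb (hw i) i).trans
        (by linarith [hw2 i])
    rw [Finset.sum_const, hcard] at h3
    have h4 : flipProb (1 + ∑ j ∈ I, a j) * ∑ j ∈ I.erase im, (a j : ℝ) ≤ 54 / 650 ∨
        flipProb (1 + ∑ j ∈ I, b j) * ∑ j ∈ I.erase jm, (b j : ℝ) ≤ 54 / 650 := by
      by_cases h : 2 ≤ a im
      · exact Or.inl (coupled_cost_le_of_two_le a him h)
      · exact Or.inr (coupled_cost_le_of_two_le b hjm (by omega))
    unfold couplingCost
    norm_num at h3 ⊢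
    rcases h4 with h4 | h4 <;> linarith

/-- The main numerical estimate: the cost of the coupling for a color that appears on the neighbors
`i ∈ I` of the disagreement. -/
theorem couplingCost_le {w0 : ℝ} (hw0 : w0 = 1 ∨ w0 = 2) (w : ι → ℝ) (hw : ∀ i, w i = 1 ∨ w i = 2)
    (a b : ι → ℕ) {im jm : ι} (him : im ∈ I) (hjm : jm ∈ I)
    (ha : 1 ≤ a im) (hb : 1 ≤ b jm) (ham : ∀ i ∈ I, a i ≤ a im) (hbm : ∀ i ∈ I, b i ≤ b jm) :
    couplingCost I w a b im jm ≤ -w0 + 1933 / 650 * ∑ i ∈ I, min w0 (w i) := by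
  have hw1 : ∀ i, 1 ≤ w i := fun i => by rcases hw i with h | h <;> norm_num [h]
  have hw2 : ∀ i, w i ≤ 2 := fun i => by rcases hw i with h | h <;> norm_num [h]
  have hcrude := couplingCost_le_card w hw a b him hjm ha hb
  have hsum1 : (I.card : ℝ) ≤ ∑ i ∈ I, w i := by
    have := Finset.sum_le_sum fun i (_ : i ∈ I) => hw1 i
    simpa using this
  have hsum2 : ∑ i ∈ I, w i ≤ 2 * I.card := by
    have := Finset.sum_le_sum fun i (_ : i ∈ I) => hw2 i
    simp only [Finset.sum_const, nsmul_eq_mul] at this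
    linarith
  by_cases hc1 : I.card = 1
  · obtain ⟨i, rfl⟩ := Finset.card_eq_one.1 hc1
    rw [Finset.mem_singleton] at him hjm
    subst him hjm
    have := couplingCost_singleton_le w jm (hw jm) a b ha hb
    rw [Finset.sum_singleton]
    rcases hw0 with rfl | rfl <;> rcases hw jm with h | h <;> rw [h] at this ⊢ <;>
      (norm_num at this ⊢; linarith)
  have hcpos : 1 ≤ I.card := Finset.card_pos.2 ⟨im, him⟩
  have hc2 : 2 ≤ I.card := by omega
  have hc2' : (2 : ℝ) ≤ I.card := by exact_mod_cast hc2
  rcases hw0 with rfl | rfl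
  · have hmin : ∑ i ∈ I, min 1 (w i) = I.card := by
      rw [Finset.sum_congr rfl fun i _ => min_eq_left (hw1 i)]
      simp
    rw [hmin]
    rcases hc2.eq_or_lt with h2 | h3
    · rw [← h2]
      obtain ⟨x, y, hxy, rfl⟩ := Finset.card_eq_two.1 h2.symm
      have hbx := hbm x (by simp)
      have hby := hbm y (by simp)
      have hax := ham x (by simp)
      have hay := ham y (by simp)
      simp only [Finset.mem_insert, Finset.mem_singleton] at him hjm
      have : couplingCost {x, y} w a b im jm ≤ 3216 / 650 := by
        rcases him with rfl | rfl
        · exact couplingCost_pair_le w hxy hw2 a b ha hay hjm hb hbx hby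
        · rw [Finset.pair_comm]
          exact couplingCost_pair_le w hxy.symm hw2 a b ha hax hjm.symm hb hby hbx
      norm_num at this ⊢
      linarith
    · rcases (show 3 ≤ I.card from h3).eq_or_lt with h3' | h4
      · have := couplingCost_three_le w hw h3'.symm a b him hjm ha hb ham hbm
        rw [← h3']
        norm_num at this ⊢
        linarith
      · have : (4 : ℝ) ≤ I.card := by exact_mod_cast h4
        linarith
  · have hmin : ∑ i ∈ I, min 2 (w i) = ∑ i ∈ I, w i :=
      Finset.sum_congr rfl fun i _ => min_eq_right (hw2 i)
    rw [hmin]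
    linarith

end

/-! ### Contraction of the flip dynamics -/

section
variable {W : Type*} {k : ℕ} {H : SimpleGraph W} {w : W → ℝ} {v : W} {X : W → Fin k}

theorem IsHammingLip.neg {W α : Type*} {w : W → ℝ} {L : ℝ} {f : (W → α) → ℝ}
    (hf : IsHammingLip w L f) : IsHammingLip w L (-f) := by
  intro v σ τ h
  have := hf v τ σ fun u hu => (h u hu).symm
  simp only [Pi.neg_apply]
  linarith

theorem adj_mem_clusterFinset [Fintype W] {u : W} {c : Fin k} (hc : c ≠ X v) (hu : H.Adj v u)
    (hX : X u = c) : u ∈ clusterFinset H X v c := by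
  rw [mem_clusterFinset, mem_cluster_iff hc]
  exact SimpleGraph.Adj.reachable ⟨hu, Or.inl ⟨rfl, hX⟩⟩

theorem sum_weight_le_of_mem [DecidableEq W] (hw : ∀ v, w v = 1 ∨ w v = 2) {A : Finset W} {i : W}
    (hi : i ∈ A) :
    ∑ u ∈ A, w u ≤ w i + 2 * ((A.card : ℝ) - 1) := by
  rw [← Finset.add_sum_erase A w hi]
  have h1 : ∑ u ∈ A.erase i, w u ≤ ∑ u ∈ A.erase i, 2 :=
    Finset.sum_le_sum fun u _ => by rcases hw u with h | h <;> norm_num [h]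
  rw [Finset.sum_const, nsmul_eq_mul, Finset.card_erase_of_mem hi,
    Nat.cast_sub (Finset.card_pos.2 ⟨i, hi⟩)] at h1
  push_cast at h1
  linarith

theorem sum_weight_le (hw : ∀ v, w v = 1 ∨ w v = 2) (A : Finset W) :
    ∑ u ∈ A, w u ≤ 2 * (A.card : ℝ) := by
  have h1 : ∑ u ∈ A, w u ≤ ∑ u ∈ A, 2 :=
    Finset.sum_le_sum fun u _ => by rcases hw u with h | h <;> norm_num [h]
  rw [Finset.sum_const, nsmul_eq_mul] at h1
  linarith

theorem clusterFinset_nonempty [Fintype W] (u : W) (e : Fin k) : 1 ≤ (clusterFinset H X u e).card :=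
  Finset.card_pos.2 ⟨u, mem_clusterFinset.2 (self_mem_cluster u e)⟩

theorem flipRate_nonneg [Fintype W] (u : W) (e : Fin k) : 0 ≤ flipRate H flipProb X u e :=
  div_nonneg (flipProb_nonneg _) (Nat.cast_nonneg _)

theorem flipRate_le_one [Fintype W] (u : W) (e : Fin k) : flipRate H flipProb X u e ≤ 1 := by
  have h : (1 : ℝ) ≤ (clusterFinset H X u e).card := by
    exact_mod_cast clusterFinset_nonempty u e
  exact (div_le_one (by linarith)).2 ((flipProb_le_one _).trans h)

theorem mul_block_weight_le [DecidableEq W] (hw : ∀ v, w v = 1 ∨ w v = 2) {A : Finset W} {i : W}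
    (hA : A.Nonempty → i ∈ A) : flipProb A.card * ∑ u ∈ A, w u ≤ w i := by
  have hwi : 0 ≤ w i := by rcases hw i with h | h <;> norm_num [h]
  rcases A.eq_empty_or_nonempty with h | h
  · simpa [h] using hwi
  · have h1 := sum_weight_le_of_mem hw (hA h)
    have h2 := mul_le_mul_of_nonneg_left h1 (flipProb_nonneg A.card)
    refine h2.trans ?_
    rcases (show 1 ≤ A.card from Finset.card_pos.2 h).eq_or_lt with h3 | h3
    · rw [← h3, flipProb_one]; norm_num
    · have h4 := mul_flipProb_le_of_two_le h3
      have h5 := flipProb_nonneg A.card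
      rcases hw i with h | h <;> rw [h] <;> nlinarith

theorem sum_mul_add_residualRate [DecidableEq W] {I : Finset W} (a : W → ℕ) {im : W}
    (him : im ∈ I) (g : W → ℝ) :
    ∑ i ∈ I, flipProb (a i) * g i =
      ∑ i ∈ I, residualRate I a im i * g i + flipProb (1 + ∑ j ∈ I, a j) * g im := by
  have h1 : ∑ i ∈ I, (if i = im then flipProb (1 + ∑ j ∈ I, a j) else 0) * g i =
      flipProb (1 + ∑ j ∈ I, a j) * g im := by
    simp [ite_mul, him]
  rw [← h1, ← Finset.sum_add_distrib]
  refine Finset.sum_congr rfl fun i _ => ?_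
  unfold residualRate
  ring

end

section
variable {W : Type*} [Fintype W] [DecidableEq W] {k : ℕ} {H : SimpleGraph W}
  {w : W → ℝ} {f : (W → Fin k) → ℝ} {v : W} {X Y : W → Fin k}

/-- The contribution to `P f(X) - P f(Y)` of the cluster `S_X(v, c)` and of the clusters of `Y`
that it contains, which are listed by `A`. -/
noncomputable def sideTerm (H : SimpleGraph W) (f : (W → Fin k) → ℝ) (X Y : W → Fin k) (v : W)
    (c : Fin k) (I : Finset W) (A : W → Finset W) : ℝ :=
  flipProb (clusterFinset H X v c).card * (f (flipCluster H X v c) - f X) -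
    ∑ i ∈ I, flipProb (A i).card * (f (swapOn Y (A i) (X v) c) - f Y)

/-- The color `c = Y v` of the disagreement itself: here only `S_X(v, c)` is a nontrivial cluster
at `v`, and if it is coupled to a cluster of `Y` then the two colorings coalesce. Neighbors of `v`
can have this color because the colorings need not be proper. -/
theorem sideTerm_special_le (hw : ∀ v, w v = 1 ∨ w v = 2) (hf : IsHammingLip w 1 f)
    (hXY : ∀ u, u ≠ v → X u = Y u) (hne : X v ≠ Y v)
    {I : Finset W} (hI : ∀ u, u ∈ I ↔ H.Adj v u ∧ X u = Y v) {A : W → Finset W}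
    (hA : IsBlockDecomposition H Y X v (Y v) I A) :
    sideTerm H f X Y v (Y v) I A ≤
      (1 + I.card) * (w v - (f X - f Y)) - w v + 1933 / 650 * ∑ i ∈ I, min (w v) (w i) := by
  have hbase : f X - f Y ≤ w v := by simpa using hf v X Y hXY
  have hS : ∀ u, u ∈ I → u ∈ clusterFinset H X v (Y v) := fun u hu =>
    adj_mem_clusterFinset hne.symm ((hI u).1 hu).1 ((hI u).1 hu).2
  have hvS : v ∈ clusterFinset H X v (Y v) := mem_clusterFinset.2 (self_mem_cluster _ _)
  set S := clusterFinset H X v (Y v) with hSdef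
  have hflip : f (flipCluster H X v (Y v)) - f X ≤ 2 * S.card := by
    have h1 := hf.sub_le S (flipCluster H X v (Y v)) X (fun u hu => by
      rw [flipCluster_eq_swapOn, swapOn_of_notMem _ _ hu])
    linarith [sum_weight_le hw S]
  have hcrude : I.Nonempty → flipProb S.card * (f (flipCluster H X v (Y v)) - f X) ≤ 548 / 650 := by
    rintro ⟨u, hu⟩
    have h2 : 2 ≤ S.card := by
      refine Finset.one_lt_card.2 ⟨u, hS u hu, v, hvS, ?_⟩
      rintro rfl
      exact ((hI u).1 hu).1.ne rfl
    have h3 := mul_le_mul_of_nonneg_left hflip (flipProb_nonneg S.card)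
    linarith [mul_flipProb_le_of_two_le h2]
  have hblock : ∀ i, f Y - f (swapOn Y (A i) (X v) (Y v)) ≤ ∑ u ∈ A i, w u := fun i => by
    have := hf.sub_le (A i) Y (swapOn Y (A i) (X v) (Y v)) (fun u hu => by
      rw [swapOn_of_notMem _ _ hu])
    linarith
  unfold sideTerm
  rw [← hSdef]
  rcases Nat.lt_or_ge I.card 2 with hlt | hge
  · rcases Nat.lt_or_ge I.card 1 with h0 | h1
    · have hI0 : I = ∅ := Finset.card_eq_zero.1 (by omega)
      have hS1 := hA.empty hI0
      have hY : flipCluster H X v (Y v) = Y := by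
        funext u
        rw [flipCluster_eq_swapOn, hS1]
        by_cases hu : u = v
        · subst hu; simp [swapOn]
        · rw [swapOn_of_notMem _ _ (by simpa using hu), hXY u hu]
      rw [hSdef, hS1, hY, hI0]
      simp [flipProb_one]
    · obtain ⟨u, hu⟩ := Finset.card_eq_one.1 (by omega : I.card = 1)
      have huI : u ∈ I := by simp [hu]
      have hc := hcrude ⟨u, huI⟩
      simp only [hu, Finset.sum_singleton, Finset.card_singleton, Nat.cast_one]
      rcases (A u).eq_empty_or_nonempty with hAe | hAn
      · rw [hAe, Finset.card_empty, flipProb_zero, zero_mul, sub_zero]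
        rcases hw v with h | h <;> rcases hw u with h' | h' <;> rw [h] at hbase ⊢ <;>
          rw [h'] <;> norm_num at hc ⊢ <;> linarith
      · have hAS := hA.single u hu hAn
        have hcard : S.card = (A u).card + 1 := by
          rw [hAS, Finset.card_erase_add_one hvS]
        have hcoal : flipCluster H X v (Y v) = swapOn Y (A u) (X v) (Y v) := by
          funext z
          rw [flipCluster_eq_swapOn, ← hSdef, hAS]
          by_cases hz : z = v
          · subst hz
            rw [swapOn_of_mem _ _ hvS, swapOn_of_notMem _ _ (by simp), Equiv.swap_apply_left]
          · by_cases hzS : z ∈ S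
            · rw [swapOn_of_mem _ _ hzS, swapOn_of_mem _ _ (Finset.mem_erase.2 ⟨hz, hzS⟩), hXY z hz]
            · rw [swapOn_of_notMem _ _ hzS, swapOn_of_notMem _ _ fun h =>
                hzS (Finset.mem_of_mem_erase h), hXY z hz]
        have hAc : 1 ≤ (A u).card := Finset.card_pos.2 hAn
        have hwt := (hblock u).trans (sum_weight_le_of_mem hw (hA.rep_mem u hAn))
        have hD0 : 0 ≤ flipProb (A u).card - flipProb ((A u).card + 1) :=
          sub_nonneg.2 (flipProb_anti hAc (Nat.le_succ _))
        have h1 := mul_le_mul_of_nonneg_left hwt hD0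
        have h2 := sub_one_mul_flipProb_sub_le hAc
        have h3 := flipProb_sub_le hAc
        have h4 : (flipProb (A u).card - flipProb ((A u).card + 1)) * w u ≤ 513 / 650 * w u :=
          mul_le_mul_of_nonneg_right h3 (by rcases hw u with h | h <;> norm_num [h])
        have h5 : flipProb ((A u).card + 1) * (w v - (f X - f Y)) ≤ 1 * (w v - (f X - f Y)) :=
          mul_le_mul_of_nonneg_right (flipProb_le_one _) (by linarith)
        have h6 : 0 ≤ flipProb ((A u).card + 1) * w v :=
          mul_nonneg (flipProb_nonneg _) (by rcases hw v with h | h <;> norm_num [h])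
        have h7 : 513 / 650 * w u + 120 / 650 ≤ - w v + 1933 / 650 * min (w v) (w u) := by
          rcases hw v with h | h <;> rcases hw u with h' | h' <;> rw [h, h'] <;> norm_num
        rw [hcoal, hcard]
        linarith
  · have h1 := hcrude (Finset.card_pos.1 (by omega))
    have h2 : -∑ i ∈ I, flipProb (A i).card * (f (swapOn Y (A i) (X v) (Y v)) - f Y) ≤
        ∑ i ∈ I, w i := by
      rw [← Finset.sum_neg_distrib]
      refine Finset.sum_le_sum fun i _ => ?_
      have h3 := mul_le_mul_of_nonneg_left (hblock i) (flipProb_nonneg (A i).card)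
      linarith [mul_block_weight_le hw (hA.rep_mem i)]
    have h3 : 0 ≤ (1 + I.card : ℝ) * (w v - (f X - f Y)) :=
      mul_nonneg (by positivity) (by linarith)
    have hge' : (2 : ℝ) ≤ I.card := by exact_mod_cast hge
    have h4 : ∑ i ∈ I, w i + 548 / 650 ≤ - w v + 1933 / 650 * ∑ i ∈ I, min (w v) (w i) := by
      rcases hw v with h | h
      · rw [h, Finset.sum_congr rfl fun i _ => min_eq_left
          (show (1 : ℝ) ≤ w i by rcases hw i with h | h <;> norm_num [h])]
        have := sum_weight_le hw I
        simp only [Finset.sum_const, nsmul_eq_mul]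
        linarith
      · rw [h, Finset.sum_congr rfl fun i _ => min_eq_right
          (show w i ≤ 2 by rcases hw i with h | h <;> norm_num [h])]
        have : ∑ i ∈ I, (1 : ℝ) ≤ ∑ i ∈ I, w i := Finset.sum_le_sum fun i _ => by
          rcases hw i with h | h <;> norm_num [h]
        simp only [Finset.sum_const, nsmul_eq_mul] at this
        linarith
    linarith

/-- The coupling for a color `c` different from `X v` and `Y v`. -/
theorem sideTerm_sub_le_couplingCost (hw : ∀ v, w v = 1 ∨ w v = 2) (hf : IsHammingLip w 1 f)
    (hXY : ∀ u, u ≠ v → X u = Y u) (hne : X v ≠ Y v) {c : Fin k} (hcX : c ≠ X v) (hcY : c ≠ Y v)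
    {I : Finset W} {A B : W → Finset W}
    (hA : IsBlockDecomposition H Y X v c I A) (hB : IsBlockDecomposition H X Y v c I B)
    {im jm : W} (him : im ∈ I) (hjm : jm ∈ I) (ha : 1 ≤ (A im).card) (hb : 1 ≤ (B jm).card) :
    sideTerm H f X Y v c I A - sideTerm H f Y X v c I B ≤
      (1 + I.card) * (w v - (f X - f Y)) +
        couplingCost I w (fun i => (A i).card) (fun i => (B i).card) im jm := by
  have hbase : f X - f Y ≤ w v := by simpa using hf v X Y hXY
  have hw0 : ∀ u, 0 ≤ w u := fun u => by rcases hw u with h | h <;> norm_num [h]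
  set a : W → ℕ := fun i => (A i).card with hadef
  set b : W → ℕ := fun i => (B i).card with hbdef
  set q := residualRate I a im with hq
  set q' := residualRate I b jm with hq'
  have hq0 : ∀ i, 0 ≤ q i := residualRate_nonneg a him ha
  have hq0' : ∀ i, 0 ≤ q' i := residualRate_nonneg b hjm hb
  -- sizes of the two large clusters
  have card_eq : ∀ {X Y : W → Fin k} {A : W → Finset W}, Y v ≠ X v → c ≠ Y v →
      IsBlockDecomposition H Y X v c I A →
      (clusterFinset H X v c).card = 1 + ∑ i ∈ I, (A i).card := by
    intro X Y A hne hc hA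
    have hv : v ∈ clusterFinset H X v c := mem_clusterFinset.2 (self_mem_cluster _ _)
    rw [← Finset.card_erase_add_one hv, hA.biUnion hne hc,
      Finset.card_biUnion fun i _ j _ hij => hA.disjoint i j hij, add_comm]
  -- a large cluster flipped together with one of its blocks
  have large : ∀ {X Y : W → Fin k} {A : W → Finset W} {im : W}, (∀ u, u ≠ v → X u = Y u) →
      Y v ≠ X v → c ≠ Y v → im ∈ I → IsBlockDecomposition H Y X v c I A → ∀ u,
      u ∉ insert v ((I.erase im).biUnion A) →
      flipCluster H X v c u = swapOn Y (A im) (X v) c u := by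
    intro X Y A im hXY hne hc him hA u hu
    simp only [Finset.mem_insert, not_or] at hu
    rw [flipCluster_eq_swapOn]
    by_cases hum : u ∈ A im
    · have := Finset.mem_of_mem_erase (hA.subset im hum)
      rw [swapOn_of_mem _ _ hum, swapOn_of_mem _ _ this, hXY u hu.1]
    · have : u ∉ clusterFinset H X v c := by
        intro h
        have h1 : u ∈ (clusterFinset H X v c).erase v := Finset.mem_erase.2 ⟨hu.1, h⟩
        rw [hA.biUnion hne hc, ← Finset.insert_erase him, Finset.biUnion_insert,
          Finset.mem_union] at h1
        exact h1.elim hum hu.2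
      rw [swapOn_of_notMem _ _ hum, swapOn_of_notMem _ _ this, hXY u hu.1]
  have weight : ∀ {X Y : W → Fin k} {A : W → Finset W} {im : W},
      IsBlockDecomposition H Y X v c I A →
      ∑ u ∈ insert v ((I.erase im).biUnion A), w u ≤
        w v + 2 * ∑ i ∈ I.erase im, ((A i).card : ℝ) := by
    intro X Y A im hA
    have hv : v ∉ (I.erase im).biUnion A := by
      intro h
      obtain ⟨i, _, hi⟩ := Finset.mem_biUnion.1 h
      exact (Finset.mem_erase.1 (hA.subset i hi)).1 rfl
    rw [Finset.sum_insert hv, Finset.sum_biUnion fun i _ j _ hij => hA.disjoint i j hij,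
      Finset.mul_sum]
    gcongr with i
    exact sum_weight_le hw _
  have hSX := hf.sub_le _ (flipCluster H X v c) (swapOn Y (A im) (X v) c)
    (large hXY hne.symm hcY him hA)
  have hSY := hf.sub_le _ (swapOn X (B jm) (Y v) c) (flipCluster H Y v c)
    (fun u hu => (large (fun u hu => (hXY u hu).symm) hne hcX hjm hB u hu).symm)
  have hWX := weight (im := im) hA
  have hWY := weight (im := jm) hB
  have hcX' := card_eq hne.symm hcY hA
  have hcY' := card_eq hne hcX hB
  -- blocks flipped outside the coupling with the large clusters
  have index : ∀ i ∈ I, q' i * (f (swapOn X (B i) (Y v) c) - f X) -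
      q i * (f (swapOn Y (A i) (X v) c) - f Y) ≤
      min (q i) (q' i) * (w v - (f X - f Y)) +
      (2 * ((a i : ℝ) - 1) * q i + 2 * ((b i : ℝ) - 1) * q' i + w i * max (q i) (q' i)) := by
    intro i _
    have hx : f (swapOn X (B i) (Y v) c) - f X ≤ ∑ u ∈ B i, w u := by
      have := hf.sub_le (B i) (swapOn X (B i) (Y v) c) X (fun u hu => swapOn_of_notMem _ _ hu)
      linarith
    have hy : f Y - f (swapOn Y (A i) (X v) c) ≤ ∑ u ∈ A i, w u := by
      have := hf.sub_le (A i) Y (swapOn Y (A i) (X v) c)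
        (fun u hu => (swapOn_of_notMem _ _ hu).symm)
      linarith
    have hsplit : max (q i) (q' i) = q i + q' i - min (q i) (q' i) := by
      linarith [min_add_max (q i) (q' i)]
    rcases (A i).eq_empty_or_nonempty with hAe | hAn
    · have hq00 : q i = 0 := residualRate_eq_zero a ha (by simp [hadef, hAe])
      rw [hq00, min_eq_left (hq0' i), max_eq_right (hq0' i)]
      rcases (B i).eq_empty_or_nonempty with hBe | hBn
      · have hq00' : q' i = 0 := residualRate_eq_zero b hb (by simp [hbdef, hBe])
        rw [hq00']; simp
      · have h1 := hx.trans (sum_weight_le_of_mem hw (hB.rep_mem i hBn))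
        have h2 := mul_le_mul_of_nonneg_left h1 (hq0' i)
        simp only [hbdef]
        linarith
    rcases (B i).eq_empty_or_nonempty with hBe | hBn
    · have hq00 : q' i = 0 := residualRate_eq_zero b hb (by simp [hbdef, hBe])
      rw [hq00, min_eq_right (hq0 i), max_eq_left (hq0 i)]
      have h1 := hy.trans (sum_weight_le_of_mem hw (hA.rep_mem i hAn))
      have h2 := mul_le_mul_of_nonneg_left h1 (hq0 i)
      simp only [hadef]
      linarith
    have hiA := hA.rep_mem i hAn
    have hiB := hB.rep_mem i hBn
    have hα := sum_weight_le_of_mem hw hiA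
    have hβ := sum_weight_le_of_mem hw hiB
    -- the representative belongs to both blocks, so its weight is counted only once
    have hboth : f (swapOn X (B i) (Y v) c) - f (swapOn Y (A i) (X v) c) ≤
        w v + ∑ u ∈ A i, w u + ∑ u ∈ B i, w u - w i := by
      have h1 := hf.sub_le (insert v (A i ∪ (B i).erase i)) (swapOn X (B i) (Y v) c)
        (swapOn Y (A i) (X v) c) (fun u hu => by
          simp only [Finset.mem_insert, Finset.mem_union, Finset.mem_erase, not_or] at hu
          obtain ⟨huv, huA, huB⟩ := hu
          have huB' : u ∉ B i := by
            intro h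
            have : u ≠ i := by rintro rfl; exact huA hiA
            exact huB ⟨this, h⟩
          rw [swapOn_of_notMem _ _ huA, swapOn_of_notMem _ _ huB', hXY u huv])
      have h2 : ∑ u ∈ insert v (A i ∪ (B i).erase i), w u ≤
          w v + (∑ u ∈ A i, w u + ∑ u ∈ (B i).erase i, w u) := by
        have hv : v ∉ A i ∪ (B i).erase i := by
          intro h
          rcases Finset.mem_union.1 h with h | h
          · exact (Finset.mem_erase.1 (hA.subset i h)).1 rfl
          · exact (Finset.mem_erase.1 (hB.subset i (Finset.mem_of_mem_erase h))).1 rfl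
        rw [Finset.sum_insert hv]
        gcongr
        have := Finset.sum_union_inter (s₁ := A i) (s₂ := (B i).erase i) (f := w)
        have h3 := Finset.sum_nonneg fun u (_ : u ∈ A i ∩ (B i).erase i) => hw0 u
        linarith
      have h3 := Finset.add_sum_erase (B i) w hiB
      linarith
    have hμ0 : 0 ≤ min (q i) (q' i) := le_min (hq0 i) (hq0' i)
    have e1 := mul_le_mul_of_nonneg_left hboth hμ0
    have e2 := mul_le_mul_of_nonneg_left hx (sub_nonneg.2 (min_le_right (q i) (q' i)))
    have e3 := mul_le_mul_of_nonneg_left hy (sub_nonneg.2 (min_le_left (q i) (q' i)))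
    have e4 := mul_le_mul_of_nonneg_left hα (hq0 i)
    have e5 := mul_le_mul_of_nonneg_left hβ (hq0' i)
    rw [hsplit]
    simp only [hadef, hbdef]
    generalize min (q i) (q' i) = μ at *
    linarith
  have hsum := Finset.sum_le_sum index
  rw [Finset.sum_sub_distrib, Finset.sum_add_distrib, ← Finset.sum_mul] at hsum
  have hPA : flipProb (1 + ∑ j ∈ I, a j) ≤ 137 / 650 := by
    refine flipProb_le_of_two_le ?_
    have h1 : a im ≤ ∑ j ∈ I, a j := Finset.single_le_sum (fun _ _ => Nat.zero_le _) him
    have h2 : 1 ≤ a im := ha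
    omega
  have hPB : flipProb (1 + ∑ j ∈ I, b j) ≤ 137 / 650 := by
    refine flipProb_le_of_two_le ?_
    have h1 : b jm ≤ ∑ j ∈ I, b j := Finset.single_le_sum (fun _ _ => Nat.zero_le _) hjm
    have h2 : 1 ≤ b jm := hb
    omega
  have hμ : ∑ i ∈ I, min (q i) (q' i) ≤ I.card := by
    have : ∑ i ∈ I, min (q i) (q' i) ≤ ∑ i ∈ I, (1 : ℝ) := Finset.sum_le_sum fun i _ =>
      (min_le_left _ _).trans ((residualRate_le a im i).trans (flipProb_le_one _))
    simpa using this
  -- total rate of the moves in which both colorings change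
  have hmass : (flipProb (1 + ∑ j ∈ I, a j) + flipProb (1 + ∑ j ∈ I, b j) +
      ∑ i ∈ I, min (q i) (q' i)) * (w v - (f X - f Y)) ≤ (1 + I.card) * (w v - (f X - f Y)) :=
    mul_le_mul_of_nonneg_right (by linarith) (by linarith)
  unfold sideTerm
  rw [hcX', hcY', sum_mul_add_residualRate a him, sum_mul_add_residualRate b hjm]
  have l1 := mul_le_mul_of_nonneg_left (hSX.trans (by linarith :
    1 * ∑ u ∈ insert v ((I.erase im).biUnion A), w u ≤
      w v + 2 * ∑ i ∈ I.erase im, (a i : ℝ))) (flipProb_nonneg (1 + ∑ j ∈ I, a j))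
  have l2 := mul_le_mul_of_nonneg_left (hSY.trans (by linarith :
    1 * ∑ u ∈ insert v ((I.erase jm).biUnion B), w u ≤
      w v + 2 * ∑ i ∈ I.erase jm, (b i : ℝ))) (flipProb_nonneg (1 + ∑ j ∈ I, b j))
  unfold couplingCost
  simp only [← hq, ← hq']
  change flipProb (1 + ∑ j ∈ I, a j) * _ - _ - (flipProb (1 + ∑ j ∈ I, b j) * _ - _) ≤ _
  linarith

/-- The contribution of a color `c` different from `X v` and `Y v`. -/
theorem sideTerm_sub_le (hw : ∀ v, w v = 1 ∨ w v = 2) (hf : IsHammingLip w 1 f)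
    (hXY : ∀ u, u ≠ v → X u = Y u) (hne : X v ≠ Y v) {c : Fin k} (hcX : c ≠ X v) (hcY : c ≠ Y v)
    {I : Finset W} (hI : ∀ u, u ∈ I ↔ H.Adj v u ∧ X u = c) {A B : W → Finset W}
    (hA : IsBlockDecomposition H Y X v c I A) (hB : IsBlockDecomposition H X Y v c I B) :
    sideTerm H f X Y v c I A - sideTerm H f Y X v c I B ≤
      (1 + I.card) * (w v - (f X - f Y)) - w v + 1933 / 650 * ∑ i ∈ I, min (w v) (w i) := by
  rcases I.eq_empty_or_nonempty with h | ⟨u, hu⟩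
  · have hSX := hA.empty h
    have hSY := hB.empty h
    have hflip : flipCluster H X v c = flipCluster H Y v c := by
      funext u
      rw [flipCluster_eq_swapOn, flipCluster_eq_swapOn, hSX, hSY]
      by_cases hu : u = v
      · subst hu; simp [swapOn]
      · rw [swapOn_of_notMem _ _ (by simpa using hu), swapOn_of_notMem _ _ (by simpa using hu),
          hXY u hu]
    simp [sideTerm, hSX, hSY, hflip, h, flipProb_one]
  · -- a block of maximal size is nonempty because the blocks cover the large cluster
    have exists_max : ∀ {X Y : W → Fin k} {A : W → Finset W}, (∀ u, u ≠ v → X u = Y u) →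
        Y v ≠ X v → c ≠ Y v → c ≠ X v → X u = c → IsBlockDecomposition H Y X v c I A →
        ∃ im ∈ I, (∀ i ∈ I, (A i).card ≤ (A im).card) ∧ 1 ≤ (A im).card := by
      intro X Y A hXY hne hc hc' huc hA
      obtain ⟨im, him, hmax⟩ := Finset.exists_max_image I (fun i => (A i).card) ⟨u, hu⟩
      refine ⟨im, him, hmax, ?_⟩
      have h1 : u ∈ (clusterFinset H X v c).erase v :=
        Finset.mem_erase.2 ⟨((hI u).1 hu).1.ne', adj_mem_clusterFinset hc' ((hI u).1 hu).1 huc⟩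
      rw [hA.biUnion hne hc] at h1
      obtain ⟨i, hi, hui⟩ := Finset.mem_biUnion.1 h1
      exact (show 1 ≤ (A i).card from Finset.card_pos.2 ⟨u, hui⟩).trans (hmax i hi)
    have hu' := (hI u).1 hu
    obtain ⟨im, him, ham, ha⟩ := exists_max hXY hne.symm hcY hcX hu'.2 hA
    obtain ⟨jm, hjm, hbm, hb⟩ := exists_max (fun u hu => (hXY u hu).symm) hne hcX hcY
      (by rw [← hXY u hu'.1.ne']; exact hu'.2) hB
    have h1 := sideTerm_sub_le_couplingCost hw hf hXY hne hcX hcY hA hB him hjm ha hb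
    have h2 := couplingCost_le (hw v) w hw (fun i => (A i).card) (fun i => (B i).card) him hjm
      ha hb ham hbm
    linarith

open Classical in
/-- The pairs whose clusters avoid the disagreement `v` in both colorings. -/
noncomputable def farPairs (H : SimpleGraph W) (X Y : W → Fin k) (v : W) : Finset (W × Fin k) :=
  Finset.univ.filter fun q => q.2 ≠ X q.1 ∧ v ∉ clusterFinset H X q.1 q.2 ∧
    v ∉ clusterFinset H Y q.1 q.2

theorem ne_of_mem_farPairs {q : W × Fin k} (hq : q ∈ farPairs H X Y v) : q.1 ≠ v := by
  rintro rfl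
  simp only [farPairs, Finset.mem_filter] at hq
  exact hq.2.2.1 (mem_clusterFinset.2 (self_mem_cluster _ _))

theorem farPairs_comm (hXY : ∀ u, u ≠ v → X u = Y u) : farPairs H X Y v = farPairs H Y X v := by
  ext q
  by_cases hv : q.1 = v
  · exact ⟨fun h => absurd hv (ne_of_mem_farPairs h), fun h => absurd hv (ne_of_mem_farPairs h)⟩
  · simp only [farPairs, Finset.mem_filter, hXY _ hv]
    tauto

/-- The moves of the chain from `X`, grouped by cluster. -/
theorem sum_flipRate_eq (hXY : ∀ u, u ≠ v → X u = Y u) (g : (W → Fin k) → ℝ) (hg : g X = 0)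
    {I : Fin k → Finset W} {B : Fin k → W → Finset W}
    (hB : ∀ c, c ≠ Y v → IsBlockDecomposition H X Y v c (I c) (B c)) :
    ∑ q : W × Fin k, flipRate H flipProb X q.1 q.2 * g (flipCluster H X q.1 q.2) =
      ∑ q ∈ farPairs H X Y v, flipRate H flipProb X q.1 q.2 * g (flipCluster H X q.1 q.2) +
      ∑ c with c ≠ X v, flipProb (clusterFinset H X v c).card * g (flipCluster H X v c) +
      ∑ c with c ≠ Y v, ∑ i ∈ I c, flipProb (B c i).card * g (swapOn X (B c i) (Y v) c) := by
  set F : W → Fin k → ℝ := fun u e => flipRate H flipProb X u e * g (flipCluster H X u e) with hF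
  have h1 : ∑ c with c ≠ X v, flipProb (clusterFinset H X v c).card * g (flipCluster H X v c) =
      ∑ q : W × Fin k with q.2 ≠ X q.1 ∧ v ∈ clusterFinset H X q.1 q.2, F q.1 q.2 := by
    rw [sum_pairs_mem_cluster v F]
    refine Finset.sum_congr rfl fun c hc => ?_
    rw [Finset.mem_filter] at hc
    exact (sum_flipRate_cluster flipProb g hc.2).symm
  have h2 : ∑ c with c ≠ Y v, ∑ i ∈ I c, flipProb (B c i).card * g (swapOn X (B c i) (Y v) c) =
      ∑ q : W × Fin k with q.2 ≠ Y q.1 ∧ v ∈ clusterFinset H Y q.1 q.2,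
        if v ∉ clusterFinset H X q.1 q.2 then F q.1 q.2 else 0 := by
    rw [sum_pairs_mem_cluster v (fun u e => if v ∉ clusterFinset H X u e then F u e else 0)]
    refine Finset.sum_congr rfl fun c hc => ?_
    rw [Finset.mem_filter] at hc
    exact ((hB c hc.2).sum_eq flipProb g flipProb_zero).symm
  rw [h1, h2, farPairs, Finset.sum_filter, Finset.sum_filter, Finset.sum_filter,
    ← Finset.sum_add_distrib, ← Finset.sum_add_distrib]
  refine Finset.sum_congr rfl fun q _ => ?_
  have hself : q.2 = X q.1 → F q.1 q.2 = 0 := by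
    intro h
    simp only [hF]
    rw [h, flipCluster_self, hg, mul_zero]
  change F q.1 q.2 = _
  by_cases hv : q.1 = v
  · have hm : v ∈ clusterFinset H X q.1 q.2 :=
      mem_clusterFinset.2 (hv ▸ self_mem_cluster q.1 q.2)
    by_cases he : q.2 = X q.1
    · rw [hself he]; simp [hm]
    · simp [hm, he]
  · rw [← hXY _ hv]
    by_cases he : q.2 = X q.1
    · rw [hself he]; simp [he]
    · by_cases hmX : v ∈ clusterFinset H X q.1 q.2 <;>
        by_cases hmY : v ∈ clusterFinset H Y q.1 q.2 <;> simp [he, hmX, hmY, hF]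

/-- There is room for the coupled moves: all pairs at `v`, and one pair at each neighbor of `v`,
involve the disagreement. -/
theorem card_farPairs_add_le [DecidableRel H.Adj] (hXY : ∀ u, u ≠ v → X u = Y u) :
    (farPairs H X Y v).card + k + (Finset.univ.filter (H.Adj v)).card ≤ Fintype.card W * k := by
  set Z₁ : Finset (W × Fin k) := Finset.univ.image fun c => (v, c) with hZ₁
  set Z₂ : Finset (W × Fin k) := (Finset.univ.filter (H.Adj v)).image
    fun u => (u, if X u = X v then Y v else X v) with hZ₂
  have c1 : Z₁.card = k := by
    rw [hZ₁, Finset.card_image_of_injective _ fun _ _ h => (Prod.mk.inj h).2]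
    simp
  have c2 : Z₂.card = (Finset.univ.filter (H.Adj v)).card :=
    Finset.card_image_of_injective _ fun _ _ h => (Prod.mk.inj h).1
  have d1 : Disjoint (farPairs H X Y v) Z₁ := by
    refine Finset.disjoint_left.2 fun q hq hZ => ?_
    obtain ⟨c, _, rfl⟩ := Finset.mem_image.1 hZ
    exact ne_of_mem_farPairs hq rfl
  have d2 : Disjoint (farPairs H X Y v ∪ Z₁) Z₂ := by
    refine Finset.disjoint_left.2 fun q hq hZ => ?_
    obtain ⟨u, hu, rfl⟩ := Finset.mem_image.1 hZ
    simp only [Finset.mem_filter, Finset.mem_univ, true_and] at hu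
    rcases Finset.mem_union.1 hq with hq | hq
    · simp only [farPairs, Finset.mem_filter, Finset.mem_univ, true_and, mem_clusterFinset] at hq
      obtain ⟨h1, h2, h3⟩ := hq
      by_cases hc : X u = X v
      · simp only [hc, if_true] at h1 h3
        have hY : Y v ≠ Y u := by rw [← hXY u hu.ne', hc]; exact h1
        rw [mem_cluster_iff hY] at h3
        exact h3 (SimpleGraph.Adj.reachable ⟨hu.symm, Or.inl ⟨rfl, rfl⟩⟩)
      · simp only [hc, if_false] at h1 h2
        rw [mem_cluster_iff h1] at h2
        exact h2 (SimpleGraph.Adj.reachable ⟨hu.symm, Or.inl ⟨rfl, rfl⟩⟩)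
    · obtain ⟨c, _, h⟩ := Finset.mem_image.1 hq
      exact hu.ne (Prod.mk.inj h).1
  have := Finset.card_le_univ (farPairs H X Y v ∪ Z₁ ∪ Z₂)
  rw [Finset.card_union_of_disjoint d2, Finset.card_union_of_disjoint d1, c1, c2,
    Fintype.card_prod, Fintype.card_fin] at this
  exact this

/-- Far clusters are the same in both colorings and are flipped simultaneously. -/
theorem sum_farPairs_le (hf : IsHammingLip w 1 f) (hXY : ∀ u, u ≠ v → X u = Y u) :
    ∑ q ∈ farPairs H X Y v, flipRate H flipProb X q.1 q.2 * (f (flipCluster H X q.1 q.2) - f X) -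
      ∑ q ∈ farPairs H X Y v, flipRate H flipProb Y q.1 q.2 * (f (flipCluster H Y q.1 q.2) - f Y) ≤
    (farPairs H X Y v).card * (w v - (f X - f Y)) := by
  have hbase : f X - f Y ≤ w v := by simpa using hf v X Y hXY
  rw [← Finset.sum_sub_distrib, ← nsmul_eq_mul]
  refine Finset.sum_le_card_nsmul _ _ _ fun q hq => ?_
  have hq1 := ne_of_mem_farPairs hq
  simp only [farPairs, Finset.mem_filter, Finset.mem_univ, true_and, mem_clusterFinset] at hq
  have hcl := cluster_eq_of_notMem hXY hq.2.1 hq.2.2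
  have hrate : flipRate H flipProb Y q.1 q.2 = flipRate H flipProb X q.1 q.2 := by
    unfold flipRate
    rw [clusterFinset_congr hcl]
  have hd := hf v (flipCluster H X q.1 q.2) (flipCluster H Y q.1 q.2) (fun u hu => by
    unfold flipCluster
    rw [hcl, hXY u hu, hXY _ hq1])
  have h0 := flipRate_nonneg (H := H) (X := X) q.1 q.2
  have h1 := flipRate_le_one (H := H) (X := X) q.1 q.2
  rw [hrate, ← mul_sub]
  calc _ ≤ flipRate H flipProb X q.1 q.2 * (w v - (f X - f Y)) :=
        mul_le_mul_of_nonneg_left (by linarith) h0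
    _ ≤ _ := mul_le_of_le_one_left (by linarith) h1

end

/-- The flip dynamics contracts the weighted Hamming distance once `k > (1933 / 650) D`, where `D`
bounds the weighted degrees. -/
theorem flip_contraction {W : Type*} [Fintype W] [DecidableEq W] {k : ℕ} (H : SimpleGraph W)
    [DecidableRel H.Adj] {w : W → ℝ} (hw : ∀ v, w v = 1 ∨ w v = 2) {D : ℝ} (hD : 0 ≤ D)
    (hdeg : ∀ v, ∑ u with H.Adj v u, min (w v) (w u) ≤ w v * D) (hk : 0 < k)
    {f : (W → Fin k) → ℝ} (hf : IsHammingLip w 1 f) :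
    IsHammingLip w (1 - (k - 1933 / 650 * D) / (Fintype.card W * k))
      ((flipMatrix H flipProb k).mulVec f) := by
  intro v X Y hXY
  have : Nonempty W := ⟨v⟩
  have hcard : (1 : ℝ) ≤ Fintype.card W := by
    exact_mod_cast Fintype.card_pos_iff.2 ⟨v⟩
  have hk' : (1 : ℝ) ≤ k := by exact_mod_cast hk
  have hN : (0 : ℝ) < Fintype.card W * k := by nlinarith
  have hwv : 0 < w v := by rcases hw v with h | h <;> norm_num [h]
  by_cases hne : X v = Y v
  · have : X = Y := funext fun u => by
      by_cases hu : u = v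
      · rw [hu, hne]
      · exact hXY u hu
    rw [this, sub_self]
    refine mul_nonneg ?_ hwv.le
    rw [sub_nonneg, div_le_one hN]
    nlinarith
  have hbase : f X - f Y ≤ w v := by simpa using hf v X Y hXY
  have hYX : ∀ u, u ≠ v → Y u = X u := fun u hu => (hXY u hu).symm
  set I : Fin k → Finset W := fun c => (Finset.univ.filter (H.Adj v)).filter (X · = c) with hIdef
  have hIX : ∀ c u, u ∈ I c ↔ H.Adj v u ∧ X u = c := by simp [hIdef]
  have hIY : ∀ c u, u ∈ I c ↔ H.Adj v u ∧ Y u = c := fun c u => by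
    rw [hIX]
    exact and_congr_right fun hu => by rw [hXY u hu.ne']
  have hexB : ∀ c, ∃ block, c ≠ Y v → IsBlockDecomposition H X Y v c (I c) block := fun c => by
    by_cases h : c = Y v
    · exact ⟨fun _ => ∅, fun h' => absurd h h'⟩
    · exact (exists_isBlockDecomposition hXY h (hIY c)).imp fun _ hb _ => hb
  have hexA : ∀ c, ∃ block, c ≠ X v → IsBlockDecomposition H Y X v c (I c) block := fun c => by
    by_cases h : c = X v
    · exact ⟨fun _ => ∅, fun h' => absurd h h'⟩
    · exact (exists_isBlockDecomposition hYX h (hIX c)).imp fun _ hb _ => hb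
  choose B hB using hexB
  choose A hA using hexA
  have eX := sum_flipRate_eq hXY (fun τ => f τ - f X) (sub_self _) hB
  have eY := sum_flipRate_eq hYX (fun τ => f τ - f Y) (sub_self _) hA
  rw [← farPairs_comm hXY] at eY
  have hfar := sum_farPairs_le (H := H) hf hXY
  have hcolor : ∀ c, (if c ≠ X v then sideTerm H f X Y v c (I c) (A c) else 0) -
      (if c ≠ Y v then sideTerm H f Y X v c (I c) (B c) else 0) ≤
      (1 + (I c).card) * (w v - (f X - f Y)) - w v +
        1933 / 650 * ∑ i ∈ I c, min (w v) (w i) := by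
    intro c
    by_cases hcX : c = X v
    · -- the color `X v` is the color `Y v` after the two colorings are interchanged
      subst hcX
      have h1 := sideTerm_special_le hw hf.neg hYX (Ne.symm hne) (hIY (X v)) (hB _ hne)
      have h2 : sideTerm H (-f) Y X v (X v) (I (X v)) (B (X v)) =
          -sideTerm H f Y X v (X v) (I (X v)) (B (X v)) := by
        simp only [sideTerm, Pi.neg_apply, neg_sub]
        rw [← sub_eq_zero]
        ring_nf
        simp only [← Finset.sum_add_distrib, sub_eq_add_neg, neg_add, neg_neg,
          ← Finset.sum_neg_distrib]
        exact Finset.sum_eq_zero fun i _ => by ring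
      rw [h2] at h1
      simp only [Pi.neg_apply] at h1
      rw [if_neg (not_not.2 rfl), if_pos hne]
      linarith
    · by_cases hcY : c = Y v
      · subst hcY
        have h1 := sideTerm_special_le hw hf hXY hne (hIX (Y v)) (hA _ hcX)
        rw [if_pos hcX, if_neg (not_not.2 rfl), sub_zero]
        exact h1
      · rw [if_pos hcX, if_pos hcY]
        exact sideTerm_sub_le hw hf hXY hne hcX hcY (hIX c) (hA c hcX) (hB c hcY)
  have hsum := Finset.sum_le_sum fun c (_ : c ∈ Finset.univ) => hcolor c
  rw [Finset.sum_sub_distrib, ← Finset.sum_filter, ← Finset.sum_filter, Finset.sum_add_distrib,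
    Finset.sum_sub_distrib, ← Finset.sum_mul, ← Finset.mul_sum, Finset.sum_add_distrib,
    Finset.sum_fiberwise] at hsum
  have hcardI : ∑ c, ((I c).card : ℝ) = (Finset.univ.filter (H.Adj v)).card := by
    have := Finset.card_eq_sum_card_fiberwise (f := X) (s := Finset.univ.filter (H.Adj v))
      (t := Finset.univ) (fun _ _ => Finset.mem_coe.2 (Finset.mem_univ _))
    rw [this]
    push_cast
    rfl
  rw [hcardI] at hsum
  simp only [sideTerm, Finset.sum_sub_distrib (s := Finset.univ.filter _), Finset.sum_const,
    Finset.card_univ, Fintype.card_fin, nsmul_eq_mul, mul_one] at hsum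
  have hroom : ((farPairs H X Y v).card + k + (Finset.univ.filter (H.Adj v)).card : ℝ) ≤
      Fintype.card W * k := by
    exact_mod_cast card_farPairs_add_le hXY
  -- the coefficient of `w v - (f X - f Y) ≥ 0` may be increased to the number of all pairs
  have hroom' := mul_le_mul_of_nonneg_right hroom (sub_nonneg.2 hbase)
  have mX := flipMatrix_mulVec (H := H) flipProb hk f X
  have mY := flipMatrix_mulVec (H := H) flipProb hk f Y
  have hdegv := hdeg v
  have key : (Fintype.card W * k : ℝ) *
      ((flipMatrix H flipProb k).mulVec f X - (flipMatrix H flipProb k).mulVec f Y) ≤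
      (Fintype.card W * k - (k - 1933 / 650 * D)) * w v := by
    rw [mul_sub, mX, mY, eX, eY]
    linarith
  rw [← mul_le_mul_iff_right₀ hN]
  calc _ ≤ _ := key
    _ = _ := by field_simp

/-! ### Proper colorings: invariance and reversibility -/

section
variable {W : Type*} {k : ℕ} {H : SimpleGraph W} {σ τ : W → Fin k}

/-- `σ` is a proper vertex coloring of `H`. -/
def IsProperColoring (H : SimpleGraph W) (σ : W → Fin k) : Prop :=
  ∀ u v, H.Adj u v → σ u ≠ σ v

theorem IsProperColoring.glauber (hσ : IsProperColoring H σ) (v : W) (c : Fin k) :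
    IsProperColoring H (glauberUpdate H σ v c) := by
  classical
  by_cases hb : ∃ w, H.Adj v w ∧ σ w = c
  · rwa [glauberUpdate_of_exists hb]
  · rw [glauberUpdate_of_not_exists hb]
    push Not at hb
    intro u w huw
    by_cases hu : u = v
    · subst hu
      rw [Function.update_self, Function.update_of_ne huw.ne']
      exact (hb w huw).symm
    · by_cases hw : w = v
      · subst hw
        rw [Function.update_self, Function.update_of_ne hu]
        exact hb u huw.symm
      · rw [Function.update_of_ne hu, Function.update_of_ne hw]
        exact hσ u w huw

theorem mem_cluster_of_adj {u w v : W} {c : Fin k} (hc : c ≠ σ v) (hu : u ∈ cluster H σ v c)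
    (huw : H.Adj u w) (hne : σ u ≠ σ w) (hw : σ w = σ v ∨ σ w = c) : w ∈ cluster H σ v c := by
  have hcol := color_of_mem_cluster hu
  rw [mem_cluster_iff hc] at hu ⊢
  refine hu.trans (SimpleGraph.Adj.reachable ⟨huw, ?_⟩)
  rcases hcol with h | h <;> rcases hw with h' | h'
  · exact absurd (h.trans h'.symm) hne
  · exact Or.inl ⟨h, h'⟩
  · exact Or.inr ⟨h, h'⟩
  · exact absurd (h.trans h'.symm) hne

theorem flipCluster_of_mem {v u : W} {c : Fin k} (hu : u ∈ cluster H σ v c) :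
    flipCluster H σ v c u = Equiv.swap (σ v) c (σ u) := if_pos hu

theorem flipCluster_of_notMem {v u : W} {c : Fin k} (hu : u ∉ cluster H σ v c) :
    flipCluster H σ v c u = σ u := if_neg hu

/-- Flipping a cluster does not affect whether a site has one of the two colors of the cluster. -/
theorem flipCluster_color_iff (v u : W) (c : Fin k) :
    (flipCluster H σ v c u = σ v ∨ flipCluster H σ v c u = c) ↔ (σ u = σ v ∨ σ u = c) := by
  by_cases hu : u ∈ cluster H σ v c
  · rw [flipCluster_of_mem hu]
    rcases color_of_mem_cluster hu with h | h <;> simp [h]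
  · rw [flipCluster_of_notMem hu]

theorem IsProperColoring.flip (hσ : IsProperColoring H σ) (v : W) (c : Fin k) :
    IsProperColoring H (flipCluster H σ v c) := by
  by_cases hc : c = σ v
  · subst hc; rwa [flipCluster_self]
  have key : ∀ u w, H.Adj u w → u ∈ cluster H σ v c → w ∉ cluster H σ v c →
      flipCluster H σ v c u ≠ flipCluster H σ v c w := by
    intro u w huw hu hw heq
    refine hw (mem_cluster_of_adj hc hu huw (hσ u w huw) ?_)
    rw [← flipCluster_color_iff (H := H) v w c, ← heq, flipCluster_color_iff]
    exact color_of_mem_cluster hu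
  intro u w huw
  by_cases hu : u ∈ cluster H σ v c <;> by_cases hw : w ∈ cluster H σ v c
  · rw [flipCluster_of_mem hu, flipCluster_of_mem hw]
    exact (Equiv.injective _).ne (hσ u w huw)
  · exact key u w huw hu hw
  · exact (key w u huw.symm hw hu).symm
  · rw [flipCluster_of_notMem hu, flipCluster_of_notMem hw]
    exact hσ u w huw

theorem flipCluster_apply_self (v : W) (c : Fin k) : flipCluster H σ v c v = c := by
  rw [flipCluster_of_mem (self_mem_cluster v c), Equiv.swap_apply_left]

/-- For proper colorings a flip does not change the alternating graph of the two colors involved;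
this is what makes flips reversible. -/
theorem IsProperColoring.alternatingGraph_flipCluster (hσ : IsProperColoring H σ) {v : W}
    {c : Fin k} :
    alternatingGraph H (flipCluster H σ v c) (σ v) c = alternatingGraph H σ (σ v) c := by
  have iff_color : ∀ {ρ : W → Fin k} (_ : IsProperColoring H ρ) (u w : W),
      (alternatingGraph H ρ (σ v) c).Adj u w ↔
        H.Adj u w ∧ (ρ u = σ v ∨ ρ u = c) ∧ (ρ w = σ v ∨ ρ w = c) := by
    intro ρ hρ u w
    refine and_congr_right fun huw => ?_
    have hne := hρ u w huw
    constructor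
    · rintro (⟨h1, h2⟩ | ⟨h1, h2⟩)
      · exact ⟨Or.inl h1, Or.inr h2⟩
      · exact ⟨Or.inr h1, Or.inl h2⟩
    · rintro ⟨h1 | h1, h2 | h2⟩
      · exact absurd (h1.trans h2.symm) hne
      · exact Or.inl ⟨h1, h2⟩
      · exact Or.inr ⟨h1, h2⟩
      · exact absurd (h1.trans h2.symm) hne
  ext u w
  rw [iff_color (hσ.flip v c), iff_color hσ, flipCluster_color_iff, flipCluster_color_iff]

theorem IsProperColoring.cluster_flipCluster (hσ : IsProperColoring H σ) {v : W}
    {c : Fin k} (hc : c ≠ σ v) :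
    cluster H (flipCluster H σ v c) v (σ v) = cluster H σ v c := by
  ext w
  have hc' : σ v ≠ flipCluster H σ v c v := by
    rw [flipCluster_apply_self]; exact hc.symm
  rw [mem_cluster_iff hc', mem_cluster_iff hc, flipCluster_apply_self, alternatingGraph_comm,
    hσ.alternatingGraph_flipCluster]

theorem IsProperColoring.flipCluster_flipCluster (hσ : IsProperColoring H σ) {v : W}
    {c : Fin k} (hc : c ≠ σ v) :
    flipCluster H (flipCluster H σ v c) v (σ v) = σ := by
  funext w
  have hcl := hσ.cluster_flipCluster hc
  by_cases hw : w ∈ cluster H σ v c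
  · rw [flipCluster_of_mem (hcl ▸ hw), flipCluster_apply_self, flipCluster_of_mem hw,
      Equiv.swap_comm, Equiv.swap_apply_self]
  · rw [flipCluster_of_notMem (hcl ▸ hw), flipCluster_of_notMem hw]

end

section
variable {W : Type*} [Fintype W] {k : ℕ} {H : SimpleGraph W} {σ τ : W → Fin k}

theorem glauberMatrix_nonneg (σ τ : W → Fin k) : 0 ≤ glauberMatrix H k σ τ := by
  unfold glauberMatrix
  refine mul_nonneg (by positivity) (Finset.sum_nonneg fun v _ => Finset.sum_nonneg fun c _ => ?_)
  split_ifs <;> norm_num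

theorem glauberMatrix_eq_zero (hσ : IsProperColoring H σ) (hτ : ¬ IsProperColoring H τ) :
    glauberMatrix H k σ τ = 0 := by
  unfold glauberMatrix
  rw [Finset.sum_eq_zero, mul_zero]
  refine fun v _ => Finset.sum_eq_zero fun c _ => if_neg ?_
  rintro rfl
  exact hτ (hσ.glauber v c)

theorem glauberMatrix_symm (hσ : IsProperColoring H σ) (hτ : IsProperColoring H τ) :
    glauberMatrix H k σ τ = glauberMatrix H k τ σ := by
  classical
  by_cases hne : σ = τ
  · rw [hne]
  have key : ∀ {σ τ : W → Fin k}, σ ≠ τ → ∀ v,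
      (∑ c, if glauberUpdate H σ v c = τ then (1 : ℝ) else 0) =
        if glauberUpdate H σ v (τ v) = τ then 1 else 0 := by
    intro σ τ hne v
    refine Finset.sum_eq_single_of_mem (τ v) (Finset.mem_univ _) fun c _ hc => if_neg ?_
    intro h
    by_cases hb : ∃ w, H.Adj v w ∧ σ w = c
    · rw [glauberUpdate_of_exists hb] at h
      exact hne h
    · rw [glauberUpdate_of_not_exists hb] at h
      rw [← h, Function.update_self] at hc
      exact hc rfl
  have back : ∀ {σ τ : W → Fin k}, IsProperColoring H σ → σ ≠ τ → ∀ v,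
      glauberUpdate H σ v (τ v) = τ → glauberUpdate H τ v (σ v) = σ := by
    intro σ τ hσ hne v h
    by_cases hb : ∃ w, H.Adj v w ∧ σ w = τ v
    · rw [glauberUpdate_of_exists hb] at h
      exact absurd h hne
    · rw [glauberUpdate_of_not_exists hb] at h
      have hother : ∀ u, u ≠ v → τ u = σ u := fun u hu => by
        rw [← h, Function.update_of_ne hu]
      rw [glauberUpdate_of_not_exists]
      · funext u
        by_cases hu : u = v
        · subst hu; simp
        · rw [Function.update_of_ne hu, hother u hu]
      · rintro ⟨u, hu, hu'⟩
        rw [hother u hu.ne'] at hu'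
        exact hσ v u hu hu'.symm
  unfold glauberMatrix
  congr 1
  refine Finset.sum_congr rfl fun v _ => ?_
  rw [key hne, key (Ne.symm hne)]
  exact if_congr ⟨back hσ hne v, back hτ (Ne.symm hne) v⟩ rfl rfl

/-- The entries of the flip matrix in terms of `flipRate`, for arbitrary decidability instances. -/
theorem flipMatrix_apply (σ τ : W → Fin k) [Decidable (σ = τ)]
    [∀ v c, Decidable (flipCluster H σ v c = τ)] :
    flipMatrix H flipProb k σ τ = (1 / ((Fintype.card W : ℝ) * (k : ℝ))) *
      ∑ v : W, ∑ c : Fin k, (flipRate H flipProb σ v c *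
        (if flipCluster H σ v c = τ then 1 else 0) +
        (1 - flipRate H flipProb σ v c) * (if σ = τ then 1 else 0)) := by
  unfold flipMatrix
  simp only [ncard_cluster, flipRate]
  congr!

theorem flipMatrix_nonneg (σ τ : W → Fin k) : 0 ≤ flipMatrix H flipProb k σ τ := by
  classical
  rw [flipMatrix_apply]
  refine mul_nonneg (by positivity) (Finset.sum_nonneg fun v _ => Finset.sum_nonneg fun c _ => ?_)
  have h1 := flipRate_nonneg (H := H) (X := σ) v c
  have h2 := flipRate_le_one (H := H) (X := σ) v c
  split_ifs <;> linarith

theorem flipMatrix_eq_zero (hσ : IsProperColoring H σ) (hτ : ¬ IsProperColoring H τ) :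
    flipMatrix H flipProb k σ τ = 0 := by
  classical
  rw [flipMatrix_apply, Finset.sum_eq_zero, mul_zero]
  refine fun v _ => Finset.sum_eq_zero fun c _ => ?_
  rw [if_neg, if_neg]
  · simp
  · rintro rfl
    exact hτ hσ
  · rintro rfl
    exact hτ (hσ.flip v c)

theorem flipMatrix_symm (hσ : IsProperColoring H σ) (hτ : IsProperColoring H τ) :
    flipMatrix H flipProb k σ τ = flipMatrix H flipProb k τ σ := by
  classical
  by_cases hne : σ = τ
  · rw [hne]
  have key : ∀ {σ τ : W → Fin k}, σ ≠ τ → ∀ v,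
      ∑ c, (flipRate H flipProb σ v c * (if flipCluster H σ v c = τ then (1 : ℝ) else 0) +
        (1 - flipRate H flipProb σ v c) * (if σ = τ then 1 else 0)) =
      flipRate H flipProb σ v (τ v) * (if flipCluster H σ v (τ v) = τ then 1 else 0) := by
    intro σ τ hne v
    simp only [if_neg hne, mul_zero, add_zero]
    refine Finset.sum_eq_single_of_mem (τ v) (Finset.mem_univ _) fun c _ hc => ?_
    rw [if_neg, mul_zero]
    rintro rfl
    exact hc (flipCluster_apply_self v c).symm
  have back : ∀ {σ τ : W → Fin k}, IsProperColoring H σ → σ ≠ τ → ∀ v,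
      flipCluster H σ v (τ v) = τ → flipCluster H τ v (σ v) = σ ∧
        flipRate H flipProb τ v (σ v) = flipRate H flipProb σ v (τ v) := by
    intro σ τ hσ hne v h
    have hc : τ v ≠ σ v := by
      intro hc
      rw [hc, flipCluster_self] at h
      exact hne h
    have h1 := hσ.flipCluster_flipCluster hc
    have h2 := hσ.cluster_flipCluster hc
    rw [h] at h1 h2
    exact ⟨h1, by unfold flipRate; rw [clusterFinset_congr h2]⟩
  rw [flipMatrix_apply, flipMatrix_apply]
  congr 1
  refine Finset.sum_congr rfl fun v _ => ?_
  rw [key hne, key (Ne.symm hne)]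
  by_cases h : flipCluster H σ v (τ v) = τ
  · obtain ⟨h1, h2⟩ := back hσ hne v h
    rw [if_pos h, if_pos h1, h2]
  · rw [if_neg h, if_neg fun h' => h (back hτ (Ne.symm hne) v h').1, mul_zero, mul_zero]

theorem glauberMatrix_mulVec_one [DecidableEq W] [Nonempty W] (hk : 0 < k) :
    (glauberMatrix H k).mulVec 1 = 1 := by
  funext σ
  rw [glauberMatrix_mulVec]
  have := Fintype.card_pos (α := W)
  simp only [Pi.one_apply, Finset.sum_const, Finset.card_univ, Fintype.card_fin, nsmul_eq_mul,
    mul_one]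
  field_simp

theorem flipMatrix_mulVec_one [DecidableEq W] [Nonempty W] (hk : 0 < k) :
    (flipMatrix H flipProb k).mulVec 1 = 1 := by
  funext σ
  have h := flipMatrix_mulVec (H := H) flipProb hk 1 σ
  have := Fintype.card_pos (α := W)
  have hN : (0 : ℝ) < Fintype.card W * k := by positivity
  simp only [Pi.one_apply, sub_self, mul_zero, Finset.sum_const_zero, add_zero] at h
  exact mul_left_cancel₀ hN.ne' h

/-- Greedy coloring. -/
theorem exists_isProperColoring [DecidableEq W] [DecidableRel H.Adj]
    (hdeg : ∀ v, (Finset.univ.filter (H.Adj v)).card < k) :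
    ∃ σ : W → Fin k, IsProperColoring H σ := by
  rcases isEmpty_or_nonempty W with hW | ⟨⟨v₀⟩⟩
  · exact ⟨fun v => isEmptyElim v, fun v => isEmptyElim v⟩
  have hk : 0 < k := (Nat.zero_le _).trans_lt (hdeg v₀)
  have key : ∀ s : Finset W, ∃ σ : W → Fin k, ∀ u ∈ s, ∀ v ∈ s, H.Adj u v → σ u ≠ σ v := by
    intro s
    induction s using Finset.induction_on with
    | empty => exact ⟨fun _ => ⟨0, hk⟩, by simp⟩
    | insert v s hv ih =>
      obtain ⟨σ, hσ⟩ := ih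
      obtain ⟨c, hc⟩ : ∃ c, c ∉ (Finset.univ.filter (H.Adj v)).image σ := by
        by_contra! hall
        have h1 := Finset.card_le_card (fun c _ => hall c : (Finset.univ : Finset (Fin k)) ⊆ _)
        rw [Finset.card_univ, Fintype.card_fin] at h1
        exact absurd (h1.trans Finset.card_image_le) (not_le.2 (hdeg v))
      have hc' : ∀ u, H.Adj v u → σ u ≠ c := by simpa using hc
      refine ⟨Function.update σ v c, ?_⟩
      intro x hx y hy hxy
      by_cases h1 : x = v
      · subst h1
        rw [Function.update_self, Function.update_of_ne hxy.ne']
        exact (hc' y hxy).symm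
      · by_cases h2 : y = v
        · subst h2
          rw [Function.update_self, Function.update_of_ne h1]
          exact hc' x hxy.symm
        · rw [Function.update_of_ne h1, Function.update_of_ne h2]
          exact hσ x (Finset.mem_of_mem_insert_of_ne hx h1) y
            (Finset.mem_of_mem_insert_of_ne hy h2) hxy
  obtain ⟨σ, hσ⟩ := key Finset.univ
  exact ⟨σ, fun u v => hσ u (Finset.mem_univ _) v (Finset.mem_univ _)⟩

end

/-- The uniform distribution is stationary for a symmetric stochastic matrix. -/
theorem isStationaryFor_uniformDist {S : Type*} [Fintype S] [Nonempty S] {P : Matrix S S ℝ}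
    (h0 : ∀ x y, 0 ≤ P x y) (h1 : ∀ x, ∑ y, P x y = 1) (hsymm : ∀ x y, P x y = P y x) :
    IsStationaryFor P (uniformDist S) where
  transition_nonneg := h0
  transition_sum := h1
  nonneg _ := by unfold uniformDist; positivity
  sum_eq_one := by
    have := Fintype.card_pos (α := S)
    simp only [uniformDist, Finset.sum_const, Finset.card_univ, nsmul_eq_mul]
    field_simp
  invariant y := by
    simp only [uniformDist, ← Finset.mul_sum]
    rw [Finset.sum_congr rfl fun x _ => hsymm x y, h1, mul_one]

/-! ### Simultaneous edge colorings -/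

section
variable {V : Type*} {G₁ G₂ : SimpleGraph V} {k : ℕ}

theorem isProperColoring_iff (σ : UnionEdge G₁ G₂ → Fin k) :
    IsProperColoring (unionLineGraph G₁ G₂) σ ↔ σ ∈ Set.range
      (Subtype.val : SimColoring G₁ G₂ k → UnionEdge G₁ G₂ → Fin k) := by
  have hrange : σ ∈ Set.range (Subtype.val : SimColoring G₁ G₂ k → UnionEdge G₁ G₂ → Fin k) ↔
      (∀ e f : UnionEdge G₁ G₂, e.1 ∈ G₁.edgeSet → f.1 ∈ G₁.edgeSet → e ≠ f →
        (∃ v, v ∈ e.1 ∧ v ∈ f.1) → σ e ≠ σ f) ∧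
      (∀ e f : UnionEdge G₁ G₂, e.1 ∈ G₂.edgeSet → f.1 ∈ G₂.edgeSet → e ≠ f →
        (∃ v, v ∈ e.1 ∧ v ∈ f.1) → σ e ≠ σ f) :=
    ⟨fun ⟨τ, hτ⟩ => hτ ▸ τ.2, fun h => ⟨⟨σ, h⟩, rfl⟩⟩
  rw [hrange]
  constructor
  · intro h
    exact ⟨fun e f he hf hne hv => h e f ⟨hne, hv, Or.inl ⟨he, hf⟩⟩,
      fun e f he hf hne hv => h e f ⟨hne, hv, Or.inr ⟨he, hf⟩⟩⟩
  · rintro ⟨h1, h2⟩ e f ⟨hne, hv, h | h⟩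
    · exact h1 e f h.1 h.2 hne hv
    · exact h2 e f h.1 h.2 hne hv

open Classical in
/-- The weight of an edge in the Hamming distance: the number of the two graphs containing it. -/
noncomputable def edgeWeight (G₁ G₂ : SimpleGraph V) (e : UnionEdge G₁ G₂) : ℝ :=
  (if e.1 ∈ G₁.edgeSet then 1 else 0) + (if e.1 ∈ G₂.edgeSet then 1 else 0)

theorem edgeWeight_eq (e : UnionEdge G₁ G₂) : edgeWeight G₁ G₂ e = 1 ∨ edgeWeight G₁ G₂ e = 2 := by
  unfold edgeWeight
  have h : e.1 ∈ G₁.edgeSet ∨ e.1 ∈ G₂.edgeSet := e.2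
  by_cases h1 : e.1 ∈ G₁.edgeSet <;> by_cases h2 : e.1 ∈ G₂.edgeSet <;>
    simp only [h1, h2, if_true, if_false, or_self] at h ⊢ <;> norm_num

/-- The smaller weight of two adjacent edges is the number of the two graphs containing both. -/
theorem min_edgeWeight_of_adj {e f : UnionEdge G₁ G₂} (h : (unionLineGraph G₁ G₂).Adj e f)
    [Decidable (e.1 ∈ G₁.edgeSet)] [Decidable (f.1 ∈ G₁.edgeSet)]
    [Decidable (e.1 ∈ G₂.edgeSet)] [Decidable (f.1 ∈ G₂.edgeSet)] :
    min (edgeWeight G₁ G₂ e) (edgeWeight G₁ G₂ f) =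
      (if e.1 ∈ G₁.edgeSet then if f.1 ∈ G₁.edgeSet then 1 else 0 else 0) +
      (if e.1 ∈ G₂.edgeSet then if f.1 ∈ G₂.edgeSet then 1 else 0 else 0) := by
  obtain ⟨-, -, h⟩ := h
  unfold edgeWeight
  by_cases h1 : e.1 ∈ G₁.edgeSet <;> by_cases h2 : e.1 ∈ G₂.edgeSet <;>
    by_cases h3 : f.1 ∈ G₁.edgeSet <;> by_cases h4 : f.1 ∈ G₂.edgeSet <;>
    simp only [h1, h2, h3, h4, if_true, if_false, and_true, and_false, or_self] at h ⊢ <;> norm_num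

end

section
variable {V : Type*} [Fintype V] {G₁ G₂ : SimpleGraph V}

open Classical in
/-- At most `2 Δ` edges of a graph of maximum degree at most `Δ` meet a given edge. -/
theorem card_incident_le (G : SimpleGraph V) [DecidableRel G.Adj] {Δ : ℕ} (hG : G.maxDegree ≤ Δ)
    (e : UnionEdge G₁ G₂) :
    (Finset.univ.filter fun f : UnionEdge G₁ G₂ =>
      f.1 ∈ G.edgeSet ∧ ∃ v, v ∈ e.1 ∧ v ∈ f.1).card ≤ 2 * Δ := by
  obtain ⟨⟨x, y⟩, hxy⟩ : ∃ p : V × V, e.1 = s(p.1, p.2) := by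
    induction h : e.1 with
    | h x y => exact ⟨(x, y), rfl⟩
  have hinj : Function.Injective fun f : UnionEdge G₁ G₂ => f.1 := Subtype.val_injective
  rw [← Finset.card_image_of_injective _ hinj]
  have hsub : (Finset.univ.filter fun f : UnionEdge G₁ G₂ =>
      f.1 ∈ G.edgeSet ∧ ∃ v, v ∈ e.1 ∧ v ∈ f.1).image (fun f => f.1) ⊆
      G.incidenceFinset x ∪ G.incidenceFinset y := by
    intro f hf
    obtain ⟨g, hg, rfl⟩ := Finset.mem_image.1 hf
    obtain ⟨-, hfG, v, hve, hvf⟩ := Finset.mem_filter.1 hg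
    rw [hxy, Sym2.mem_iff] at hve
    rw [Finset.mem_union, SimpleGraph.mem_incidenceFinset, SimpleGraph.mem_incidenceFinset]
    rcases hve with rfl | rfl
    · exact Or.inl ⟨hfG, hvf⟩
    · exact Or.inr ⟨hfG, hvf⟩
  refine (Finset.card_le_card hsub).trans ((Finset.card_union_le _ _).trans ?_)
  rw [SimpleGraph.card_incidenceFinset_eq_degree, SimpleGraph.card_incidenceFinset_eq_degree]
  have h1 := (G.degree_le_maxDegree x).trans hG
  have h2 := (G.degree_le_maxDegree y).trans hG
  omega

/-- The weighted degree bound. It is `2 Δ` per unit of weight, although an edge in both graphs may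
have almost `4 Δ` neighbors. -/
theorem sum_min_edgeWeight_le [DecidableRel G₁.Adj] [DecidableRel G₂.Adj]
    [DecidableRel (unionLineGraph G₁ G₂).Adj] {Δ : ℕ}
    (h₁ : G₁.maxDegree ≤ Δ) (h₂ : G₂.maxDegree ≤ Δ) (e : UnionEdge G₁ G₂) :
    ∑ f with (unionLineGraph G₁ G₂).Adj e f, min (edgeWeight G₁ G₂ e) (edgeWeight G₁ G₂ f) ≤
      edgeWeight G₁ G₂ e * (2 * Δ) := by
  classical
  have key : ∀ (G : SimpleGraph V) [DecidableRel G.Adj], G.maxDegree ≤ Δ →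
      ∑ f with (unionLineGraph G₁ G₂).Adj e f,
        (if e.1 ∈ G.edgeSet then if f.1 ∈ G.edgeSet then (1 : ℝ) else 0 else 0) ≤
      (if e.1 ∈ G.edgeSet then 1 else 0) * (2 * Δ) := by
    intro G _ hG
    by_cases he : e.1 ∈ G.edgeSet
    · simp only [he, if_true, one_mul]
      rw [← Finset.sum_filter, Finset.sum_const, nsmul_eq_mul, mul_one, Finset.filter_filter]
      have h1 := card_incident_le (G₁ := G₁) (G₂ := G₂) G hG e
      have h2 : (Finset.univ.filter fun f : UnionEdge G₁ G₂ =>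
          (unionLineGraph G₁ G₂).Adj e f ∧ f.1 ∈ G.edgeSet).card ≤ 2 * Δ := by
        refine le_trans (Finset.card_le_card fun f hf => ?_) h1
        rw [Finset.mem_filter] at hf ⊢
        exact ⟨hf.1, hf.2.2, hf.2.1.2.1⟩
      exact_mod_cast h2
    · simp [he]
  rw [Finset.sum_congr rfl fun f hf => min_edgeWeight_of_adj (Finset.mem_filter.1 hf).2,
    Finset.sum_add_distrib]
  have h := add_le_add (key G₁ h₁) (key G₂ h₂)
  refine h.trans (le_of_eq ?_)
  rw [edgeWeight, ← add_mul]
  congr!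

theorem card_adj_le [DecidableRel G₁.Adj] [DecidableRel G₂.Adj]
    [DecidableRel (unionLineGraph G₁ G₂).Adj] {Δ : ℕ}
    (h₁ : G₁.maxDegree ≤ Δ) (h₂ : G₂.maxDegree ≤ Δ) (e : UnionEdge G₁ G₂) :
    (Finset.univ.filter ((unionLineGraph G₁ G₂).Adj e)).card ≤ 4 * Δ := by
  have h := sum_min_edgeWeight_le h₁ h₂ e
  have h1 : ∑ f with (unionLineGraph G₁ G₂).Adj e f, (1 : ℝ) ≤
      ∑ f with (unionLineGraph G₁ G₂).Adj e f, min (edgeWeight G₁ G₂ e) (edgeWeight G₁ G₂ f) :=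
    Finset.sum_le_sum fun f _ => by
      rcases edgeWeight_eq e with he | he <;> rcases edgeWeight_eq f with hf | hf <;>
        norm_num [he, hf]
  have h2 : edgeWeight G₁ G₂ e * (2 * Δ) ≤ 2 * (2 * Δ) := by
    gcongr
    rcases edgeWeight_eq e with he | he <;> norm_num [he]
  have h3 : ((Finset.univ.filter ((unionLineGraph G₁ G₂).Adj e)).card : ℝ) ≤ 4 * Δ := by
    rw [Finset.sum_const, nsmul_eq_mul, mul_one] at h1
    linarith
  exact_mod_cast h3

theorem one_le_of_maxDegree_le [DecidableRel G₁.Adj] [DecidableRel G₂.Adj] {Δ : ℕ}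
    (h₁ : G₁.maxDegree ≤ Δ) (h₂ : G₂.maxDegree ≤ Δ) (e : UnionEdge G₁ G₂) : 1 ≤ Δ := by
  have key : ∀ (G : SimpleGraph V) [DecidableRel G.Adj], G.maxDegree ≤ Δ → e.1 ∈ G.edgeSet →
      1 ≤ Δ := by
    intro G _ hG
    induction e.1 with
    | h x y =>
      intro hxy
      have : 0 < G.degree x := (G.degree_pos_iff_exists_adj x).2 ⟨y, hxy⟩
      exact this.trans_le ((G.degree_le_maxDegree x).trans hG)
  rcases e.2 with h | h
  · exact key G₁ h₁ h
  · exact key G₂ h₂ h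

end

/-- A symmetric chain on all colorings that preserves simultaneous edge colorings and contracts
the weighted Hamming distance is rapidly mixing on the simultaneous edge colorings. -/
theorem stationary_and_mixing {n k : ℕ} {G₁ G₂ : SimpleGraph (Fin n)}
    [DecidableEq (UnionEdge G₁ G₂)] [Nonempty (UnionEdge G₁ G₂)]
    [Nonempty (SimColoring G₁ G₂ k)]
    {P : Matrix (UnionEdge G₁ G₂ → Fin k) (UnionEdge G₁ G₂ → Fin k) ℝ}
    (h0 : ∀ σ τ, 0 ≤ P σ τ) (h1 : P.mulVec 1 = 1)
    (hclosed : ∀ σ τ, IsProperColoring (unionLineGraph G₁ G₂) σ →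
      ¬ IsProperColoring (unionLineGraph G₁ G₂) τ → P σ τ = 0)
    (hsymm : ∀ σ τ, IsProperColoring (unionLineGraph G₁ G₂) σ →
      IsProperColoring (unionLineGraph G₁ G₂) τ → P σ τ = P τ σ)
    {ε : ℝ} (hε : 0 < ε) (hε1 : ε < 1)
    (hP : ∀ f, IsHammingLip (edgeWeight G₁ G₂) 1 f →
      IsHammingLip (edgeWeight G₁ G₂) (1 - ε / Fintype.card (UnionEdge G₁ G₂)) (P.mulVec f)) :
    IsStationaryFor (fun σ τ : SimColoring G₁ G₂ k => P σ.1 τ.1)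
      (uniformDist (SimColoring G₁ G₂ k)) ∧
    ∃ T : ℕ, mixingTime (fun σ τ : SimColoring G₁ G₂ k => P σ.1 τ.1)
        (uniformDist (SimColoring G₁ G₂ k)) (1 / 4) = (T : ℕ∞) ∧
      (T : ℝ) ≤ (5 / ε + 2) * (Fintype.card (UnionEdge G₁ G₂) : ℝ) * Real.log (n : ℝ) := by
  classical
  set ι : SimColoring G₁ G₂ k → UnionEdge G₁ G₂ → Fin k := Subtype.val with hιdef
  have hι : Function.Injective ι := Subtype.val_injective
  have hproper : ∀ σ : SimColoring G₁ G₂ k, IsProperColoring (unionLineGraph G₁ G₂) (ι σ) :=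
    fun σ => (isProperColoring_iff _).2 ⟨σ, rfl⟩
  have hcl : ∀ x s, s ∉ Set.range ι → P (ι x) s = 0 := fun x s hs =>
    hclosed _ _ (hproper x) fun h => hs ((isProperColoring_iff s).1 h)
  have hst : IsStationaryFor (P.submatrix ι ι) (uniformDist (SimColoring G₁ G₂ k)) := by
    refine isStationaryFor_uniformDist (fun x y => h0 _ _) (fun x => ?_)
      (fun x y => hsymm _ _ (hproper x) (hproper y))
    have h2 := congrFun (restrict_pow_mulVec hι hcl 1 1) x
    rw [pow_one, pow_one, h1] at h2
    simpa [Matrix.mulVec, dotProduct] using h2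
  refine ⟨hst, ?_⟩
  obtain ⟨e⟩ := ‹Nonempty (UnionEdge G₁ G₂)›
  have hm : 1 ≤ Fintype.card (UnionEdge G₁ G₂) := Fintype.card_pos_iff.2 ⟨e⟩
  have hn : 2 ≤ n := by
    obtain ⟨x, y, hxy⟩ : ∃ x y : Fin n, x ≠ y := by
      rcases e with ⟨e, he⟩
      induction e with
      | h x y =>
        rcases he with he | he
        · exact ⟨x, y, SimpleGraph.Adj.ne he⟩
        · exact ⟨x, y, SimpleGraph.Adj.ne he⟩
    have := x.2
    have := y.2
    have : x.1 ≠ y.1 := fun h => hxy (Fin.ext h)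
    omega
  have hmn : Fintype.card (UnionEdge G₁ G₂) ≤ n ^ 2 := by
    have h2 : Fintype.card (UnionEdge G₁ G₂) ≤ Fintype.card (Sym2 (Fin n)) :=
      Fintype.card_le_of_injective (fun e : UnionEdge G₁ G₂ => e.1) Subtype.val_injective
    have h3 : Fintype.card (Sym2 (Fin n)) ≤ Fintype.card (Fin n × Fin n) :=
      Fintype.card_le_of_surjective (fun p : Fin n × Fin n => s(p.1, p.2)) fun z => by
        induction z with
        | h x y => exact ⟨(x, y), rfl⟩
    rw [Fintype.card_prod, Fintype.card_fin] at h3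
    rw [sq]
    exact h2.trans h3
  have hm' : (1 : ℝ) ≤ Fintype.card (UnionEdge G₁ G₂) := by exact_mod_cast hm
  have hρ : 0 < 1 - ε / Fintype.card (UnionEdge G₁ G₂) := by
    rw [sub_pos, div_lt_one (by linarith)]
    linarith
  obtain ⟨t, ht1, ht2⟩ := exists_time_of_contraction hε hε1 hm hn hmn
  have htv : ∀ x, tvDist ((P.submatrix ι ι ^ t) x) (uniformDist (SimColoring G₁ G₂ k)) ≤ 1 / 4 := by
    intro x
    refine le_trans (tvDist_pow_le (w := edgeWeight G₁ G₂) (fun e => ?_) hρ hP hι hcl hst t x) ?_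
    · rcases edgeWeight_eq e with h | h <;> norm_num [h]
    · refine le_trans (mul_le_mul_of_nonneg_left ?_ (pow_nonneg hρ.le t)) ht1
      exact sum_weight_le edgeWeight_eq Finset.univ
  obtain ⟨T, hT, hTt⟩ := mixingTime_le_of_tvDist_le htv
  exact ⟨T, hT, le_trans (by exact_mod_cast hTt) ht2⟩

theorem nonempty_simColoring {n Δ k : ℕ} {G₁ G₂ : SimpleGraph (Fin n)}
    [DecidableRel G₁.Adj] [DecidableRel G₂.Adj]
    (h₁ : G₁.maxDegree ≤ Δ) (h₂ : G₂.maxDegree ≤ Δ) (hk : 4 * Δ < k) :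
    Nonempty (SimColoring G₁ G₂ k) := by
  classical
  obtain ⟨σ, hσ⟩ := exists_isProperColoring (H := unionLineGraph G₁ G₂) (k := k)
    fun e => (card_adj_le h₁ h₂ e).trans_lt hk
  obtain ⟨τ, -⟩ := (isProperColoring_iff σ).1 hσ
  exact ⟨τ⟩

theorem IsHammingLip.mono {W α : Type*} {w : W → ℝ} {L L' : ℝ} {f : (W → α) → ℝ}
    (hf : IsHammingLip w L f) (hw : ∀ v, 0 ≤ w v) (hL : L ≤ L') : IsHammingLip w L' f :=
  fun v σ τ h => (hf v σ τ h).trans (mul_le_mul_of_nonneg_right hL (hw v))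

/-- If `k` exceeds `κ` by the factor `1 / (1 - ε)`, a contraction by `1 - (k - κ) / (m k)` is a
contraction by `1 - ε / m`. -/
theorem one_sub_div_le {m k κ ε : ℝ} (hm : 0 < m) (hk : 0 < k) (h : κ ≤ (1 - ε) * k) :
    1 - (k - κ) / (m * k) ≤ 1 - ε / m := by
  have : ε / m ≤ (k - κ) / (m * k) := by
    rw [div_le_div_iff₀ hm (mul_pos hm hk)]
    nlinarith
  linarith

theorem theorem1 :
    (∀ δ : ℝ, 0 < δ → ∃ C : ℝ,
      ∀ (n Δ k : ℕ) (G₁ G₂ : SimpleGraph (Fin n)) [DecidableRel G₁.Adj] [DecidableRel G₂.Adj],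
        Nonempty (UnionEdge G₁ G₂) → G₁.maxDegree ≤ Δ → G₂.maxDegree ≤ Δ →
        (6 + δ) * (Δ : ℝ) < (k : ℝ) →
        IsStationaryFor (simGlauber G₁ G₂ k) (uniformDist (SimColoring G₁ G₂ k)) ∧
        ∃ T : ℕ,
          mixingTime (simGlauber G₁ G₂ k) (uniformDist (SimColoring G₁ G₂ k)) (1 / 4)
            = (T : ℕ∞) ∧
          (T : ℝ) ≤ C * (Fintype.card (UnionEdge G₁ G₂) : ℝ) * Real.log (n : ℝ)) ∧
    (∃ C : ℝ,
      ∀ (n Δ k : ℕ) (G₁ G₂ : SimpleGraph (Fin n)) [DecidableRel G₁.Adj] [DecidableRel G₂.Adj],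
        Nonempty (UnionEdge G₁ G₂) → G₁.maxDegree ≤ Δ → G₂.maxDegree ≤ Δ →
        (5.948 : ℝ) * (Δ : ℝ) ≤ (k : ℝ) →
        IsStationaryFor (simFlip G₁ G₂ flipProb k) (uniformDist (SimColoring G₁ G₂ k)) ∧
        ∃ T : ℕ,
          mixingTime (simFlip G₁ G₂ flipProb k) (uniformDist (SimColoring G₁ G₂ k)) (1 / 4)
            = (T : ℕ∞) ∧
          (T : ℝ) ≤ C * (Fintype.card (UnionEdge G₁ G₂) : ℝ) * Real.log (n : ℝ)) := by
  constructor
  · intro δ hδ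
    refine ⟨5 / (δ / (6 + δ)) + 2, ?_⟩
    intro n Δ k G₁ G₂ _ _ hne h₁ h₂ hk
    classical
    have hΔ : (1 : ℝ) ≤ Δ := by
      obtain ⟨e⟩ := hne
      exact_mod_cast one_le_of_maxDegree_le h₁ h₂ e
    have hkpos : (0 : ℝ) < k := lt_of_le_of_lt (by positivity) hk
    have hk0 : 0 < k := by exact_mod_cast hkpos
    have : Nonempty (SimColoring G₁ G₂ k) := nonempty_simColoring h₁ h₂ (by
      have : (4 * Δ : ℝ) < k := by nlinarith
      exact_mod_cast this)
    have hm : (0 : ℝ) < Fintype.card (UnionEdge G₁ G₂) := by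
      exact_mod_cast Fintype.card_pos
    refine stationary_and_mixing (P := glauberMatrix (unionLineGraph G₁ G₂) k)
      glauberMatrix_nonneg (glauberMatrix_mulVec_one hk0)
      (fun _ _ => glauberMatrix_eq_zero) (fun _ _ => glauberMatrix_symm) (by positivity)
      ((div_lt_one (by positivity)).2 (by linarith)) fun f hf => ?_
    refine (glauber_contraction (unionLineGraph G₁ G₂) edgeWeight_eq (by positivity)
      (sum_min_edgeWeight_le h₁ h₂) hk0 hf).mono
      (fun e => by rcases edgeWeight_eq e with h | h <;> norm_num [h]) (one_sub_div_le hm hkpos ?_)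
    have e1 : 1 - δ / (6 + δ) = 6 / (6 + δ) := by field_simp; ring
    rw [e1, div_mul_eq_mul_div, le_div_iff₀ (by positivity)]
    linarith
  · -- `(1 - 1 / 20000) * 5.948 > 2 * 1933 / 650`
    refine ⟨5 / (1 / 20000) + 2, ?_⟩
    intro n Δ k G₁ G₂ _ _ hne h₁ h₂ hk
    classical
    have hΔ : (1 : ℝ) ≤ Δ := by
      obtain ⟨e⟩ := hne
      exact_mod_cast one_le_of_maxDegree_le h₁ h₂ e
    have hkpos : (0 : ℝ) < k := lt_of_lt_of_le (by positivity) hk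
    have hk0 : 0 < k := by exact_mod_cast hkpos
    have : Nonempty (SimColoring G₁ G₂ k) := nonempty_simColoring h₁ h₂ (by
      have : (4 * Δ : ℝ) < k := by linarith
      exact_mod_cast this)
    have hm : (0 : ℝ) < Fintype.card (UnionEdge G₁ G₂) := by
      exact_mod_cast Fintype.card_pos
    refine stationary_and_mixing (P := flipMatrix (unionLineGraph G₁ G₂) flipProb k)
      flipMatrix_nonneg (flipMatrix_mulVec_one hk0)
      (fun _ _ => flipMatrix_eq_zero) (fun _ _ => flipMatrix_symm) (by norm_num)
      (by norm_num) fun f hf => ?_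
    refine (flip_contraction (unionLineGraph G₁ G₂) edgeWeight_eq (by positivity)
      (sum_min_edgeWeight_le h₁ h₂) hk0 hf).mono
      (fun e => by rcases edgeWeight_eq e with h | h <;> norm_num [h]) (one_sub_div_le hm hkpos ?_)
    linarith
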